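/- Let $a_0,a_1\in\mathbb R$, $c>0$, and let $f:\mathbb R^4\to\mathbb R^4$ be the coupled Hénon map $$f(x,y,z,w)=\bigl(a_0-x^2-z+c(x-y),\;a_1-y^2-w-c(x-y),\;x,\;y\bigr),$$ a polynomial diffeomorphism with polynomial inverse. Put $A_0=\frac{a_0+a_1}{2}$, assume $A_0\ge -1$, and let $r=2\sqrt2\,\bigl(1+\sqrt{1+A_0}\bigr)$. Let $\Omega(f)$ be the non-wandering set, i.e. the set of points all of whose neighbourhoods $U$ satisfy $f^n(U)\cap U\ne\emptyset$ for some $n\ge1$. Put $D=[-r,r]^2$ and $V_f=D\times D=\{(x,y,z,w): |x|,|y|,|z|,|w|\le r\}$, and let $\pi_1(x,y,z,w)=(x,y)$, $\pi_2(x,y,z,w)=(z,w)$. Then the following hold. (A-1) $\Omega(f)\subset V_f$. (A-2) If, for $i=0,1$, $$0<\tfrac14c^2+a_i-(c+2)r\qquad\text{and}\qquad 0\le r^2-2(c+1)r-a_i,$$ then $f$ has a topological horseshoe with four symbols on $V_f$: the set $f(V_f)\cap V_f$ is a disjoint union of four compact connected pieces $P_s$, $s\in S$, $|S|=4$, such that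 - each piece crosses $V_f$ completely in both time directions: for every $v\in D$ the map $\pi_1\circ f$ is a bijection of $f^{-1}(P_s)\cap\pi_2^{-1}(v)$ onto $D$, and for every $u\in D$ the map $\pi_2\circ f^{-1}$ is a bijection of $P_s\cap\pi_1^{-1}(u)$ onto $D$; - there is no lateral overhang: $\pi_2(P_s)$ and $\pi_1(f^{-1}(P_s))$ lie in the interior of $D$; - on the maximal invariant set $\{p: f^n(p)\in V_f\ \text{for all } n\in\mathbb Z\}$, the itinerary map $p\mapsto (s_n)_{n\in\mathbb Z}$ with $f^n(p)\in P_{s_n}$ is well defined and is a continuous surjective semi-conjugacy onto the full two-sided shift on $S^{\mathbb Z}$. (A-3) If in addition to the conditions of (A-2), for $i=0,1$, $$4+c<\frac{-c+\sqrt{c^2+4\,(a_i-(c+2)r)}}{2},$$ then $\Omega(f)$ is uniformly hyperbolic: it is compact, $f(\Omega(f))=\Omega(f)$, and there are constants $C>0$, $0<\lambda<1$ and for every $p\in\Omega(f)$ a $Df$-invariant splitting $\mathbb R^4=E^s_p\oplus E^u_p$ with $|Df^n_p v|\le C\lambda^n|v|$ for $v\in E^s_p$ and $|Df^{-n}_p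 v|\le C\lambda^n|v|$ for $v\in E^u_p$, for all $n\ge0$. -/

import Mathlib

open Set Topology

/-- Four-dimensional phase space. The point `(x, y, z, w)` is written `((x, y), (z, w))`. -/
abbrev Phase : Type := (ℝ × ℝ) × (ℝ × ℝ)

/-- The coupled Hénon map with parameters `a 0`, `a 1` and coupling strength `c`,
`(x, y, z, w) ↦ (a₀ - x² - z + c (x - y), a₁ - y² - w - c (x - y), x, y)`,
bundled with its inverse as a homeomorphism of `ℝ⁴`. -/
def coupledHenon (a : Fin 2 → ℝ) (c : ℝ) : Phase ≃ₜ Phase where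
  toFun p :=
    ((a 0 - p.1.1 ^ 2 - p.2.1 + c * (p.1.1 - p.1.2),
      a 1 - p.1.2 ^ 2 - p.2.2 - c * (p.1.1 - p.1.2)),
     (p.1.1, p.1.2))
  invFun p :=
    ((p.2.1, p.2.2),
     (a 0 - p.2.1 ^ 2 - p.1.1 + c * (p.2.1 - p.2.2),
      a 1 - p.2.2 ^ 2 - p.1.2 - c * (p.2.1 - p.2.2)))
  left_inv p := by
    obtain ⟨⟨x, y⟩, ⟨z, w⟩⟩ := p
    simp only [Prod.mk.injEq, true_and]
    constructor <;> ring
  right_inv p := by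
    obtain ⟨⟨x, y⟩, ⟨z, w⟩⟩ := p
    simp only [Prod.mk.injEq, and_true]
    constructor <;> ring
  continuous_toFun := by fun_prop
  continuous_invFun := by fun_prop

/-- The non-wandering set of a map: the points `x` all of whose neighbourhoods `U` satisfy
`fⁿ(U) ∩ U ≠ ∅` for some `n ≥ 1`. -/
def nonwanderingSet {X : Type*} [TopologicalSpace X] (f : X → X) : Set X :=
  {x | ∀ U ∈ 𝓝 x, ∃ n : ℕ, 1 ≤ n ∧ ((f^[n] '' U) ∩ U).Nonempty}

/-- `Λ` is a (uniformly) hyperbolic set of the diffeomorphism `f`: it is compact and invariant, and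
over it there is a `Df`-invariant splitting of the tangent space into a stable and an unstable
subspace, uniformly exponentially contracted by forward and by backward iteration. -/
def IsUniformlyHyperbolic {E : Type*} [NormedAddCommGroup E] [NormedSpace ℝ E]
    (f : E ≃ₜ E) (Λ : Set E) : Prop :=
  IsCompact Λ ∧ f '' Λ = Λ ∧
  ∃ (C lam : ℝ) (Es Eu : E → Submodule ℝ E), 0 < C ∧ 0 < lam ∧ lam < 1 ∧
    ∀ x ∈ Λ,
      IsCompl (Es x) (Eu x) ∧
      (Es x).map (fderiv ℝ f x : E →ₗ[ℝ] E) = Es (f x) ∧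
      (Eu x).map (fderiv ℝ f x : E →ₗ[ℝ] E) = Eu (f x) ∧
      (∀ v ∈ Es x, ∀ n : ℕ, ‖fderiv ℝ (f^[n]) x v‖ ≤ C * lam ^ n * ‖v‖) ∧
      (∀ v ∈ Eu x, ∀ n : ℕ, ‖fderiv ℝ (f.symm^[n]) x v‖ ≤ C * lam ^ n * ‖v‖)

/-- The points whose whole forward and backward `f`-orbit stays in `V`. -/
def maximalInvariantSet {X : Type*} [TopologicalSpace X] (f : X ≃ₜ X) (V : Set X) : Set X :=
  {p | ∀ n : ℤ, (f ^ n) p ∈ V}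

/-- A piece `P ⊆ f(V) ∩ V` of the image of the box `V = D₁ × D₂` (with `D₁` the unstable and `D₂`
the stable directions) penetrates `V` completely and without lateral overhang:
each unstable slice of `f⁻¹(P)` is carried by `f` bijectively across `D₁`, each stable slice of `P`
is carried by `f⁻¹` bijectively across `D₂`, and neither `P` nor `f⁻¹(P)` touches the lateral
faces of `V`. -/
def IsFullCrossing {E F : Type*} [TopologicalSpace E] [TopologicalSpace F]
    (f : E × F ≃ₜ E × F) (D₁ : Set E) (D₂ : Set F) (P : Set (E × F)) : Prop :=
  (∀ v ∈ D₂, BijOn (fun p => (f p).1) (f ⁻¹' P ∩ {p | p.2 = v}) D₁) ∧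
  (∀ u ∈ D₁, BijOn (fun p => (f.symm p).2) (P ∩ {p | p.1 = u}) D₂) ∧
  MapsTo Prod.snd P (interior D₂) ∧
  MapsTo Prod.fst (f ⁻¹' P) (interior D₁)

/-- `f` has a topological horseshoe on the box `D₁ × D₂` with symbols in `ι`:
`f(V) ∩ V` splits into connected components `P i`, one for each symbol, each of which
crosses `V` completely, and the itinerary with respect to the `P i` is a semi-conjugacy from `f` on
the maximal invariant set of `V` onto the full two-sided shift on the alphabet `ι`. -/
def HasTopologicalHorseshoe {E F : Type*} [TopologicalSpace E] [TopologicalSpace F]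
    (f : E × F ≃ₜ E × F) (D₁ : Set E) (D₂ : Set F)
    (ι : Type*) [TopologicalSpace ι] : Prop :=
  ∃ P : ι → Set (E × F),
    (⋃ i, P i) = f '' (D₁ ×ˢ D₂) ∩ D₁ ×ˢ D₂ ∧
    Pairwise (fun i j => Disjoint (P i) (P j)) ∧
    (∀ i, IsCompact (P i) ∧ IsConnected (P i) ∧ IsFullCrossing f D₁ D₂ (P i)) ∧
    ∃ h : maximalInvariantSet f (D₁ ×ˢ D₂) → (ℤ → ι),
      Continuous h ∧ Function.Surjective h ∧
      (∀ p q : maximalInvariantSet f (D₁ ×ˢ D₂),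
        (q : E × F) = f p → ∀ n : ℤ, h q n = h p (n + 1)) ∧
      (∀ p (n : ℤ), (f ^ n) (p : E × F) ∈ P (h p n))

/-!
An orbit of the coupled Hénon map `f (u, v) = (g u - v, u)` is a sequence in the plane with
`u (n + 1) + u (n - 1) = g (u n)`, where `g` is `neighbourSum`. The recursion is symmetric under
time reversal, so `f⁻¹` is conjugate to `f` by the swap of the two factors.

**Boundedness.** The sum `x + y` of the two coordinates satisfies a one-dimensional Hénon
inequality with parameter `A₀ = R² - 2 R`, where `R = 1 + √(1 + A₀)`. Below `-2 R` it is strictly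
concave along orbits, hence a strict Lyapunov function in forward or in backward time, and such
points wander. So `x + y ≥ -2 R` on the non-wandering set, and
`x² + y² = 2 A₀ - (sums at the two neighbours) ≤ 2 R²`.

**Horseshoe.** For prescribed neighbours `w`, `v` in the square the equation `g u = w + v` is
solved for the squared variables; choosing the signs of the two roots turns it into a fixed-point
equation `u = pairBranch a c s u w v`. Over the complex numbers these branches would map a polydisc
into itself, so by the Schwarz–Pick lemma they do not increase hyperbolic distances. The real form
of this estimate is `branch_density_le`, and in a polydisc slightly larger than the square it gives
a uniform contraction (`IsBranchBox.dist_branch_le`). One contraction argument then yields both the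
unique point of each quadrant between given neighbours (`existsUnique_middle`, the full crossing)
and, on sequences indexed by `ℤ`, an orbit with any prescribed itinerary
(`exists_orbit_of_itinerary`). No fixed-point theorem of Brouwer type is involved.

**Hyperbolicity.** Under the last condition the linearised recursion
`ξ (n + 1) + ξ (n - 1) = A n (ξ n)` has `‖A n ξ‖ ≥ 8 ‖ξ‖` along the non-wandering set. The stable
space consists of the vectors whose forward orbit under the derivative is bounded. Such orbits at
least halve at each step (`stable_estimates`), and solving the recursion for its middle term is a
contraction, so every second component occurs (`exists_mem_boundedSubspace`). Time reversal gives
the unstable space, and a dimension count gives the splitting.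
-/

/-! ### Fixed points of uniform contractions on sequence spaces -/

/-- A self-map of `I → E` that preserves `D`-valued families, where `D` is closed, and
contracts the supremum distance has a `D`-valued fixed point, provided that it moves some family by
a bounded amount. The index type may be infinite. -/
theorem exists_fixedPoint_of_sup_contraction {I E : Type*} [MetricSpace E] [CompleteSpace E]
    {D : Set E} (hD : IsClosed D) (T : (I → E) → I → E) {κ : ℝ} (hκ0 : 0 ≤ κ) (hκ : κ < 1)
    (hT : ∀ z, (∀ i, z i ∈ D) → ∀ i, T z i ∈ D)
    (hc : ∀ z w, (∀ i, z i ∈ D) → (∀ i, w i ∈ D) → ∀ M : ℝ, (∀ i, dist (z i) (w i) ≤ M) →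
      ∀ i, dist (T z i) (T w i) ≤ κ * M)
    (z₀ : I → E) (hz₀ : ∀ i, z₀ i ∈ D) {C : ℝ} (hC : ∀ i, dist (z₀ i) (T z₀ i) ≤ C) :
    ∃ z : I → E, (∀ i, z i ∈ D) ∧ T z = z := by
  set u : ℕ → I → E := fun k => T^[k] z₀ with hu
  have hsucc : ∀ k, u (k + 1) = T (u k) := fun k => Function.iterate_succ_apply' T k z₀
  have huD : ∀ k i, u k i ∈ D := by
    intro k
    induction k with
    | zero => exact hz₀
    | succ k ih => rw [hsucc]; exact hT _ ih
  have hstep : ∀ k i, dist (u k i) (u (k + 1) i) ≤ C * κ ^ k := by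
    intro k
    induction k with
    | zero => simpa [hu] using hC
    | succ k ih =>
      intro i
      rw [hsucc k, hsucc (k + 1)]
      calc _ ≤ κ * (C * κ ^ k) := hc _ _ (huD k) (huD (k + 1)) _ ih i
        _ = C * κ ^ (k + 1) := by ring
  have hlim : ∀ i, ∃ x, Filter.Tendsto (fun k => u k i) Filter.atTop (𝓝 x) := fun i =>
    cauchySeq_tendsto_of_complete (cauchySeq_of_le_geometric κ C hκ fun k => hstep k i)
  choose z hz using hlim
  have hzD : ∀ i, z i ∈ D := fun i =>
    hD.mem_of_tendsto (hz i) (Filter.Eventually.of_forall fun k => huD k i)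
  have hdist : ∀ k i, dist (u k i) (z i) ≤ C * κ ^ k / (1 - κ) := fun k i =>
    dist_le_of_le_geometric_of_tendsto κ C hκ (fun k => hstep k i) (hz i) k
  refine ⟨z, hzD, funext fun i => ?_⟩
  refine tendsto_nhds_unique ?_ ((Filter.tendsto_add_atTop_iff_nat 1).2 (hz i))
  rw [tendsto_iff_dist_tendsto_zero]
  have h0 : Filter.Tendsto (fun k : ℕ => κ * (C * κ ^ k / (1 - κ))) Filter.atTop (𝓝 0) := by
    have := (((tendsto_pow_atTop_nhds_zero_of_lt_one hκ0 hκ).const_mul C).div_const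
      (1 - κ)).const_mul κ
    simpa using this
  refine squeeze_zero (fun _ => dist_nonneg) (fun k => ?_) h0
  rw [hsucc]
  exact hc _ _ (huD k) hzD _ (hdist k) i

/-! ### Derivatives of the hyperbolic tangent and its inverse -/

theorem Real.hasDerivAt_tanh (x : ℝ) : HasDerivAt Real.tanh (1 - Real.tanh x ^ 2) x := by
  have h := (Real.hasDerivAt_sinh x).div (Real.hasDerivAt_cosh x) (Real.cosh_pos x).ne'
  have hf : Real.tanh = Real.sinh / Real.cosh := by
    funext y; simp [Real.tanh_eq_sinh_div_cosh]
  rw [hf]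
  refine h.congr_deriv ?_
  have := (Real.cosh_pos x).ne'
  simp only [Pi.div_apply]
  field_simp

theorem Real.hasDerivAt_artanh {x : ℝ} (hx : x ∈ Ioo (-1 : ℝ) 1) :
    HasDerivAt Real.artanh (1 - x ^ 2)⁻¹ x := by
  have h1 : (0 : ℝ) < 1 + x := by linarith [hx.1]
  have h2 : (0 : ℝ) < 1 - x := by linarith [hx.2]
  have hd : HasDerivAt (fun y : ℝ => 1 / 2 * (Real.log (1 + y) - Real.log (1 - y)))
      (1 / 2 * (1 / (1 + x) - (-1) / (1 - x))) x :=
    ((((hasDerivAt_id x).const_add 1).log h1.ne').sub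
      (((hasDerivAt_id x).const_sub 1).log h2.ne')).const_mul _
  have he : (fun y : ℝ => 1 / 2 * (Real.log (1 + y) - Real.log (1 - y))) =ᶠ[𝓝 x] Real.artanh := by
    filter_upwards [Ioo_mem_nhds hx.1 hx.2] with y hy
    rw [Real.artanh_eq_half_log ⟨hy.1.le, hy.2.le⟩, Real.log_div] <;> linarith [hy.1, hy.2]
  refine (hd.congr_of_eventuallyEq he.symm).congr_deriv ?_
  have : 1 - x ^ 2 = (1 + x) * (1 - x) := by ring
  rw [this]
  field_simp
  ring

/-! ### Contraction of the inverse branches in the hyperbolic metric -/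

/-- Infinitesimal Schwarz–Pick inequality for the branch `x ↦ c / 2 ± √(b - c x₁ - x₂ - x₃)` on the
polydisc of radius `R`: with `S` the value of the root and conformal density `1 / (R² - x²)`, the
derivative has norm at most `κ`, where `κ < 1` as soon as `q < b + (c + 2) R`. -/
theorem branch_density_le {c R b q S x₁ x₂ x₃ ε : ℝ} (hc : 0 < c) (hR : c / 2 < R)
    (hα : 0 < b - (c + 2) * R) (hβ : b + (c + 2) * R ≤ (R - c / 2) ^ 2)
    (hS : 0 < S) (hS2 : S ^ 2 = b - c * x₁ - x₂ - x₃) (hSα : b - (c + 2) * R ≤ S ^ 2)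
    (hSq : S ^ 2 ≤ q) (hq : q ≤ b + (c + 2) * R) (hε : ε = 1 ∨ ε = -1) :
    c * (R ^ 2 - x₁ ^ 2) + (R ^ 2 - x₂ ^ 2) + (R ^ 2 - x₃ ^ 2) ≤
      (1 - (b - (c + 2) * R) / q) / (1 - (b - (c + 2) * R) / (b + (c + 2) * R)) *
        (2 * S * (R ^ 2 - (c / 2 + ε * S) ^ 2)) := by
  set α := b - (c + 2) * R with hαd
  set β := b + (c + 2) * R with hβd
  set ρ := R - c / 2 with hρd
  have hρ : 0 < ρ := by linarith
  have hRpos : 0 < R := by linarith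
  have hq0 : 0 < q := lt_of_lt_of_le (by positivity) hSq
  have hβ0 : 0 < β := lt_of_lt_of_le hq0 hq
  have hβα : β - α = 2 * (c + 2) * R := by rw [hαd, hβd]; ring
  have hβα0 : 0 < β - α := by rw [hβα]; positivity
  have hSρ : S ≤ ρ := by
    by_contra h
    push Not at h
    nlinarith
  set κ := (1 - α / q) / (1 - α / β) with hκd
  have h1β : 0 < 1 - α / β := by
    rw [sub_pos, div_lt_one hβ0]; linarith
  have hκ0 : 0 ≤ κ := by
    refine div_nonneg ?_ h1β.le
    rw [sub_nonneg, div_le_one hq0]; linarith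
  -- convexity of the square collapses the three arguments to their weighted mean
  have hA : (c * (R ^ 2 - x₁ ^ 2) + (R ^ 2 - x₂ ^ 2) + (R ^ 2 - x₃ ^ 2)) * (c + 2) ≤
      (S ^ 2 - α) * (β - S ^ 2) := by
    rw [hS2, hαd, hβd]
    nlinarith [mul_nonneg hc.le (sq_nonneg (x₁ - x₂)), mul_nonneg hc.le (sq_nonneg (x₁ - x₃)),
      sq_nonneg (x₂ - x₃)]
  have hB : S ^ 2 - α ≤ κ * (S ^ 2 * (β - α) / β) := by
    have e1 : κ * (S ^ 2 * (β - α) / β) = S ^ 2 * (1 - α / q) := by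
      rw [hκd]
      have : S ^ 2 * (β - α) / β = S ^ 2 * (1 - α / β) := by field_simp
      rw [this]
      field_simp
    rw [e1]
    have e2 : S ^ 2 * (α / q) ≤ α := by
      rw [mul_div_assoc', div_le_iff₀ hq0]
      nlinarith
    linarith
  have hβS : 0 ≤ β - S ^ 2 := by linarith
  have hC : S ^ 2 * (β - S ^ 2) / β ≤ S ^ 2 * (ρ ^ 2 - S ^ 2) / ρ ^ 2 := by
    rw [div_le_div_iff₀ hβ0 (by positivity)]
    nlinarith [mul_nonneg (sq_nonneg (S ^ 2)) (sub_nonneg.2 hβ)]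
  have hE : S * (ρ + S) * R ≤ ρ ^ 2 * (2 * R - ρ + S) := by
    have hρR : ρ ≤ R := by linarith
    have h : 0 ≤ (ρ - S) * (R * S + ρ * (2 * R - ρ)) :=
      mul_nonneg (by linarith) (add_nonneg (by positivity) (mul_nonneg hρ.le (by linarith)))
    linarith [show (ρ - S) * (R * S + ρ * (2 * R - ρ)) =
      ρ ^ 2 * (2 * R - ρ + S) - S * (ρ + S) * R by ring]
  have hF : S ^ 2 * (ρ ^ 2 - S ^ 2) / ρ ^ 2 * R ≤ S * ((ρ - S) * (2 * R - ρ + S)) := by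
    rw [div_mul_eq_mul_div, div_le_iff₀ (by positivity)]
    have := mul_le_mul_of_nonneg_left hE (mul_nonneg hS.le (sub_nonneg.2 hSρ))
    linarith [show S * (ρ - S) * (S * (ρ + S) * R) = S ^ 2 * (ρ ^ 2 - S ^ 2) * R by ring]
  have hG : (ρ - S) * (2 * R - ρ + S) ≤ R ^ 2 - (c / 2 + ε * S) ^ 2 := by
    rcases hε with rfl | rfl
    · rw [hρd]; apply le_of_eq; ring
    · rw [hρd]; nlinarith [mul_pos hc hS]
  have hK : 0 < c + 2 := by linarith
  refine le_of_mul_le_mul_right ?_ hK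
  calc _ ≤ (S ^ 2 - α) * (β - S ^ 2) := hA
    _ ≤ κ * (S ^ 2 * (β - α) / β) * (β - S ^ 2) := mul_le_mul_of_nonneg_right hB hβS
    _ = κ * (2 * (c + 2) * ((S ^ 2 * (β - S ^ 2) / β) * R)) := by rw [hβα]; ring
    _ ≤ κ * (2 * (c + 2) * (S * (R ^ 2 - (c / 2 + ε * S) ^ 2))) := by
        refine mul_le_mul_of_nonneg_left (mul_le_mul_of_nonneg_left ?_ (by positivity)) hκ0
        exact (mul_le_mul_of_nonneg_right hC hRpos.le).trans
          (hF.trans (mul_le_mul_of_nonneg_left hG hS.le))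
    _ = κ * (2 * S * (R ^ 2 - (c / 2 + ε * S) ^ 2)) * (c + 2) := by ring

/-- The inverse branch `c / 2 ± √(b - c x₁ - x₂ - x₃)` of the quadratic equation
`(x - c / 2)² = b - c x₁ - x₂ - x₃`; the sign is `ε = ±1`. -/
noncomputable def henonBranch (ε b c x₁ x₂ x₃ : ℝ) : ℝ :=
  c / 2 + ε * √(b - c * x₁ - x₂ - x₃)

/-- The conditions under which every branch `henonBranch (±1) b c` maps `[-ρ, ρ]³` to `[-ρ, ρ]`
without meeting the singularity of the square root, both for `ρ = r` and for a slightly larger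
radius `ρ = R`. The interval `(-R, R)` carries the hyperbolic metric in which the branches
contract. -/
structure IsBranchBox (c b r R : ℝ) : Prop where
  c_pos : 0 < c
  c_lt : c / 2 < r
  r_lt : r < R
  root_pos : 0 < b - (c + 2) * R
  root_le : b + (c + 2) * r ≤ (r - c / 2) ^ 2
  root_le' : b + (c + 2) * R ≤ (R - c / 2) ^ 2

theorem weighted_sum_mem {c r x₁ x₂ x₃ : ℝ} (hc : 0 < c) (h₁ : x₁ ∈ Icc (-r) r)
    (h₂ : x₂ ∈ Icc (-r) r) (h₃ : x₃ ∈ Icc (-r) r) :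
    c * x₁ + x₂ + x₃ ∈ Icc (-((c + 2) * r)) ((c + 2) * r) := by
  have := mul_le_mul_of_nonneg_left h₁.1 hc.le
  have := mul_le_mul_of_nonneg_left h₁.2 hc.le
  constructor <;> linarith [h₂.1, h₂.2, h₃.1, h₃.2]

theorem IsBranchBox.branch_mem {c b r R : ℝ} (h : IsBranchBox c b r R) {ε x₁ x₂ x₃ : ℝ}
    (hε : ε = 1 ∨ ε = -1) (h₁ : x₁ ∈ Icc (-r) r) (h₂ : x₂ ∈ Icc (-r) r) (h₃ : x₃ ∈ Icc (-r) r) :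
    henonBranch ε b c x₁ x₂ x₃ ∈ Icc (-r) r := by
  have hs := weighted_sum_mem h.c_pos h₁ h₂ h₃
  have hle : √(b - c * x₁ - x₂ - x₃) ≤ r - c / 2 :=
    (Real.sqrt_le_left (by linarith [h.c_lt])).2 (by linarith [hs.1, h.root_le])
  have h0 := Real.sqrt_nonneg (b - c * x₁ - x₂ - x₃)
  have hc := h.c_pos
  rcases hε with rfl | rfl <;> constructor <;> simp only [henonBranch] <;> linarith

/-- The contraction factor of the branches in the hyperbolic metric of `(-R, R)`. -/
noncomputable def branchFactor (c b r R : ℝ) : ℝ :=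
  (1 - (b - (c + 2) * R) / (b + (c + 2) * r)) / (1 - (b - (c + 2) * R) / (b + (c + 2) * R))

theorem IsBranchBox.factor_mem {c b r R : ℝ} (h : IsBranchBox c b r R) :
    branchFactor c b r R ∈ Ico 0 1 := by
  have hc := h.c_pos
  have h1 := h.c_lt
  have h2 := h.r_lt
  have h3 := h.root_pos
  have hr : 0 < r := by linarith
  have hlt : (c + 2) * r < (c + 2) * R := mul_lt_mul_of_pos_left h2 (by linarith)
  have hr' : 0 < (c + 2) * r := by positivity
  have hβ : 0 < 1 - (b - (c + 2) * R) / (b + (c + 2) * R) := by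
    rw [sub_pos, div_lt_one (by linarith)]; linarith
  constructor
  · refine div_nonneg ?_ hβ.le
    rw [sub_nonneg, div_le_one (by linarith)]; linarith
  · rw [branchFactor, div_lt_one hβ]
    exact sub_lt_sub_left (div_lt_div_of_pos_left h3 (by linarith) (by linarith)) 1

theorem scaled_tanh_mem {r R θ : ℝ} (hr : 0 < r) (hrR : r < R) (hθ : |θ| ≤ Real.artanh (r / R)) :
    R * Real.tanh θ ∈ Icc (-r) r := by
  have hR : 0 < R := hr.trans hrR
  have h01 : r / R ∈ Ioo (-1 : ℝ) 1 :=
    ⟨by linarith [div_pos hr hR], (div_lt_one hR).2 hrR⟩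
  have h1 := Real.tanh_bijOn.mapsTo (mem_univ θ)
  have h2 : -(r / R) ∈ Ioo (-1 : ℝ) 1 := ⟨by linarith [h01.2], by linarith [h01.1]⟩
  have hneg : Real.artanh (-(r / R)) = -Real.artanh (r / R) := by
    rw [← Real.artanh_tanh (-Real.artanh (r / R)), Real.tanh_neg, Real.tanh_artanh h01]
  rw [abs_le] at hθ
  have hu : Real.tanh θ ≤ r / R := by
    rw [← Real.artanh_le_artanh_iff h1 h01, Real.artanh_tanh]; exact hθ.2
  have hl : -(r / R) ≤ Real.tanh θ := by
    rw [← Real.artanh_le_artanh_iff h2 h1, Real.artanh_tanh, hneg]; exact hθ.1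
  have e : R * (r / R) = r := by field_simp
  constructor
  · have := mul_le_mul_of_nonneg_left hl hR.le
    linarith
  · have := mul_le_mul_of_nonneg_left hu hR.le
    linarith

theorem artanh_scaled_mem {r R x : ℝ} (hr : 0 < r) (hrR : r < R) (hx : x ∈ Icc (-r) r) :
    x / R ∈ Ioo (-1 : ℝ) 1 ∧ |Real.artanh (x / R)| ≤ Real.artanh (r / R) := by
  have hR : 0 < R := hr.trans hrR
  have h01 : r / R ∈ Ioo (-1 : ℝ) 1 :=
    ⟨by linarith [div_pos hr hR], (div_lt_one hR).2 hrR⟩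
  have h2 : -(r / R) ∈ Ioo (-1 : ℝ) 1 := ⟨by linarith [h01.2], by linarith [h01.1]⟩
  have hneg : Real.artanh (-(r / R)) = -Real.artanh (r / R) := by
    rw [← Real.artanh_tanh (-Real.artanh (r / R)), Real.tanh_neg, Real.tanh_artanh h01]
  have hu : x / R ≤ r / R := div_le_div_of_nonneg_right hx.2 hR.le
  have hl : -(r / R) ≤ x / R := by
    rw [← neg_div]; exact div_le_div_of_nonneg_right hx.1 hR.le
  have hm : x / R ∈ Ioo (-1 : ℝ) 1 := ⟨by linarith [h2.1], by linarith [h01.2]⟩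
  refine ⟨hm, abs_le.2 ⟨?_, ?_⟩⟩
  · rw [← hneg]; exact (Real.artanh_le_artanh_iff h2 hm).2 hl
  · exact (Real.artanh_le_artanh_iff hm h01).2 hu

/-- The branches contract the hyperbolic metric of `(-R, R)`, in the coordinate `x = R tanh θ`. -/
theorem IsBranchBox.dist_branch_le {c b r R : ℝ} (h : IsBranchBox c b r R) {ε : ℝ}
    (hε : ε = 1 ∨ ε = -1) {θ₁ θ₂ θ₃ φ₁ φ₂ φ₃ M : ℝ}
    (hθ₁ : |θ₁| ≤ Real.artanh (r / R)) (hθ₂ : |θ₂| ≤ Real.artanh (r / R))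
    (hθ₃ : |θ₃| ≤ Real.artanh (r / R)) (hφ₁ : |φ₁| ≤ Real.artanh (r / R))
    (hφ₂ : |φ₂| ≤ Real.artanh (r / R)) (hφ₃ : |φ₃| ≤ Real.artanh (r / R))
    (h₁ : |φ₁ - θ₁| ≤ M) (h₂ : |φ₂ - θ₂| ≤ M) (h₃ : |φ₃ - θ₃| ≤ M) :
    |Real.artanh (henonBranch ε b c (R * Real.tanh φ₁) (R * Real.tanh φ₂) (R * Real.tanh φ₃) / R) -
      Real.artanh (henonBranch ε b c (R * Real.tanh θ₁) (R * Real.tanh θ₂) (R * Real.tanh θ₃) / R)|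
      ≤ branchFactor c b r R * M := by
  have hc := h.c_pos
  have hr : 0 < r := by linarith [h.c_lt]
  have hR : 0 < R := hr.trans h.r_lt
  -- the geodesic segment from `θ` to `φ`
  set X : ℝ → ℝ → ℝ → ℝ := fun θ φ t => R * Real.tanh (θ + t * (φ - θ)) with hX
  have hXm : ∀ {θ φ : ℝ}, |θ| ≤ Real.artanh (r / R) → |φ| ≤ Real.artanh (r / R) →
      ∀ t ∈ Icc (0 : ℝ) 1, X θ φ t ∈ Icc (-r) r := by
    intro θ φ hθ hφ t ht
    refine scaled_tanh_mem hr h.r_lt ?_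
    rw [abs_le] at *
    constructor <;> nlinarith [ht.1, ht.2]
  have hXd : ∀ θ φ t : ℝ, HasDerivAt (X θ φ) ((R ^ 2 - X θ φ t ^ 2) / R * (φ - θ)) t := by
    intro θ φ t
    have h0 : HasDerivAt (fun t : ℝ => θ + t * (φ - θ)) (φ - θ) t := by
      simpa using ((hasDerivAt_id t).mul_const (φ - θ)).const_add θ
    refine (((Real.hasDerivAt_tanh _).comp t h0).const_mul R).congr_deriv ?_
    simp only [hX]
    field_simp
  set F : ℝ → ℝ := fun t => Real.artanh
    (henonBranch ε b c (X θ₁ φ₁ t) (X θ₂ φ₂ t) (X θ₃ φ₃ t) / R) with hF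
  have key : ∀ t ∈ Icc (0 : ℝ) 1, ∃ d, HasDerivAt F d t ∧ ‖d‖ ≤ branchFactor c b r R * M := by
    intro t ht
    have m₁ := hXm hθ₁ hφ₁ t ht
    have m₂ := hXm hθ₂ hφ₂ t ht
    have m₃ := hXm hθ₃ hφ₃ t ht
    have hs := weighted_sum_mem hc m₁ m₂ m₃
    have hB := h.branch_mem hε m₁ m₂ m₃
    have hlt : (c + 2) * r < (c + 2) * R := mul_lt_mul_of_pos_left h.r_lt (by linarith)
    have hpos : 0 < b - c * X θ₁ φ₁ t - X θ₂ φ₂ t - X θ₃ φ₃ t := by linarith [hs.2, h.root_pos]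
    set S := √(b - c * X θ₁ φ₁ t - X θ₂ φ₂ t - X θ₃ φ₃ t) with hSd
    have hS : 0 < S := Real.sqrt_pos.2 hpos
    have hS2 : S ^ 2 = b - c * X θ₁ φ₁ t - X θ₂ φ₂ t - X θ₃ φ₃ t := Real.sq_sqrt hpos.le
    have hdens := branch_density_le (R := R) (q := b + (c + 2) * r) hc (by linarith [h.c_lt, h.r_lt])
      h.root_pos h.root_le' hS hS2 (by rw [hS2]; linarith [hs.2]) (by rw [hS2]; linarith [hs.1])
      (by linarith) hε
    have hBd : henonBranch ε b c (X θ₁ φ₁ t) (X θ₂ φ₂ t) (X θ₃ φ₃ t) = c / 2 + ε * S := rfl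
    rw [hBd] at hB
    have hm := (artanh_scaled_mem hr h.r_lt hB).1
    have hden : 0 < R ^ 2 - (c / 2 + ε * S) ^ 2 := by nlinarith [hB.1, hB.2, h.r_lt]
    have hd := (Real.hasDerivAt_artanh hm).comp t (((((((hXd θ₁ φ₁ t).const_mul c).const_sub b).sub
      (hXd θ₂ φ₂ t)).sub (hXd θ₃ φ₃ t)).sqrt hpos.ne').const_mul ε |>.const_add (c / 2)
        |>.div_const R)
    refine ⟨_, hd, ?_⟩
    have hw : ∀ {x : ℝ}, x ∈ Icc (-r) r → 0 ≤ R ^ 2 - x ^ 2 := fun {x} hx => by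
      nlinarith [hx.1, hx.2, h.r_lt]
    have hN : |c * ((R ^ 2 - X θ₁ φ₁ t ^ 2) * (φ₁ - θ₁)) + (R ^ 2 - X θ₂ φ₂ t ^ 2) * (φ₂ - θ₂) +
        (R ^ 2 - X θ₃ φ₃ t ^ 2) * (φ₃ - θ₃)| ≤
        (c * (R ^ 2 - X θ₁ φ₁ t ^ 2) + (R ^ 2 - X θ₂ φ₂ t ^ 2) + (R ^ 2 - X θ₃ φ₃ t ^ 2)) * M := by
      have k₁ := mul_le_mul_of_nonneg_left h₁ (mul_nonneg hc.le (hw m₁))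
      have k₂ := mul_le_mul_of_nonneg_left h₂ (hw m₂)
      have k₃ := mul_le_mul_of_nonneg_left h₃ (hw m₃)
      refine (abs_add_le _ _).trans ((add_le_add_left (abs_add_le _ _) _).trans ?_)
      rw [abs_mul, abs_mul, abs_mul, abs_mul, abs_of_nonneg (hw m₁), abs_of_nonneg (hw m₂),
        abs_of_nonneg (hw m₃), abs_of_pos hc]
      linarith
    have hM : 0 ≤ M := (abs_nonneg _).trans h₁
    have hεabs : |ε| = 1 := by rcases hε with rfl | rfl <;> simp
    have hform : (1 - ((c / 2 + ε * S) / R) ^ 2)⁻¹ *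
        (ε * ((-(c * ((R ^ 2 - X θ₁ φ₁ t ^ 2) / R * (φ₁ - θ₁))) -
          (R ^ 2 - X θ₂ φ₂ t ^ 2) / R * (φ₂ - θ₂) - (R ^ 2 - X θ₃ φ₃ t ^ 2) / R * (φ₃ - θ₃)) /
          (2 * S)) / R) =
        -ε * (c * ((R ^ 2 - X θ₁ φ₁ t ^ 2) * (φ₁ - θ₁)) + (R ^ 2 - X θ₂ φ₂ t ^ 2) * (φ₂ - θ₂) +
        (R ^ 2 - X θ₃ φ₃ t ^ 2) * (φ₃ - θ₃)) / (2 * S * (R ^ 2 - (c / 2 + ε * S) ^ 2)) := by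
      have e1 : 1 - ((c / 2 + ε * S) / R) ^ 2 = (R ^ 2 - (c / 2 + ε * S) ^ 2) / R ^ 2 := by
        field_simp
      rw [e1]
      generalize R ^ 2 - (c / 2 + ε * S) ^ 2 = Q at hden
      generalize R ^ 2 - X θ₁ φ₁ t ^ 2 = Q₁
      generalize R ^ 2 - X θ₂ φ₂ t ^ 2 = Q₂
      generalize R ^ 2 - X θ₃ φ₃ t ^ 2 = Q₃
      field_simp
      ring
    refine (congrArg norm hform).trans_le ?_
    rw [Real.norm_eq_abs, abs_div, abs_mul, abs_neg, hεabs, one_mul,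
      abs_of_pos (mul_pos (mul_pos two_pos hS) hden),
      div_le_iff₀ (mul_pos (mul_pos two_pos hS) hden)]
    refine hN.trans ((mul_le_mul_of_nonneg_right hdens hM).trans (le_of_eq ?_))
    rw [branchFactor]
    ring
  choose! F' hF' hbd using key
  have := Convex.norm_image_sub_le_of_norm_hasDerivWithin_le (f := F) (f' := F')
    (fun t ht => (hF' t ht).hasDerivWithinAt) hbd (convex_Icc (0 : ℝ) 1)
    (left_mem_Icc.2 zero_le_one) (right_mem_Icc.2 zero_le_one)
  simpa [hF, hX] using this

/-- The sign `±1` named by a Boolean. -/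
def boolSign (b : Bool) : ℝ := if b then 1 else -1

theorem boolSign_eq (b : Bool) : boolSign b = 1 ∨ boolSign b = -1 := by
  cases b <;> simp [boolSign]

/-- The hyperbolic coordinate `θ = artanh (u / R)` on `(-R, R)²`. -/
noncomputable def hypCoord (R : ℝ) (u : ℝ × ℝ) : ℝ × ℝ :=
  (Real.artanh (u.1 / R), Real.artanh (u.2 / R))

/-- The inverse `u = R tanh θ` of `hypCoord`. -/
noncomputable def hypPoint (R : ℝ) (θ : ℝ × ℝ) : ℝ × ℝ :=
  (R * Real.tanh θ.1, R * Real.tanh θ.2)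

theorem hypPoint_mem {r R : ℝ} (hr : 0 < r) (hrR : r < R) {θ : ℝ × ℝ}
    (hθ : ‖θ‖ ≤ Real.artanh (r / R)) : hypPoint R θ ∈ Icc (-r) r ×ˢ Icc (-r) r :=
  ⟨scaled_tanh_mem hr hrR ((norm_fst_le θ).trans hθ),
    scaled_tanh_mem hr hrR ((norm_snd_le θ).trans hθ)⟩

theorem norm_hypCoord_le {r R : ℝ} (hr : 0 < r) (hrR : r < R) {u : ℝ × ℝ}
    (hu : u ∈ Icc (-r) r ×ˢ Icc (-r) r) : ‖hypCoord R u‖ ≤ Real.artanh (r / R) :=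
  norm_prod_le_iff.2 ⟨(artanh_scaled_mem hr hrR hu.1).2, (artanh_scaled_mem hr hrR hu.2).2⟩

theorem hypCoord_hypPoint {R : ℝ} (hR : 0 < R) (θ : ℝ × ℝ) : hypCoord R (hypPoint R θ) = θ := by
  simp [hypCoord, hypPoint, mul_div_cancel_left₀ _ hR.ne', Real.artanh_tanh]

theorem hypPoint_hypCoord {r R : ℝ} (hr : 0 < r) (hrR : r < R) {u : ℝ × ℝ}
    (hu : u ∈ Icc (-r) r ×ˢ Icc (-r) r) : hypPoint R (hypCoord R u) = u := by
  have hR : 0 < R := hr.trans hrR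
  ext
  · simp only [hypPoint, hypCoord]
    rw [Real.tanh_artanh (artanh_scaled_mem hr hrR hu.1).1]
    field_simp
  · simp only [hypPoint, hypCoord]
    rw [Real.tanh_artanh (artanh_scaled_mem hr hrR hu.2).1]
    field_simp

/-- Existence and uniqueness of a fixed point for a self-map of the square-valued families that
contracts the supremum of the hyperbolic distances. -/
theorem existsUnique_fixedPoint_of_hyp_contraction {I : Type*} {r R κ : ℝ} (hr : 0 < r)
    (hrR : r < R) (hκ0 : 0 ≤ κ) (hκ : κ < 1) (T : (I → ℝ × ℝ) → I → ℝ × ℝ)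
    (hT : ∀ z, (∀ i, z i ∈ Icc (-r) r ×ˢ Icc (-r) r) → ∀ i, T z i ∈ Icc (-r) r ×ˢ Icc (-r) r)
    (hc : ∀ z w, (∀ i, z i ∈ Icc (-r) r ×ˢ Icc (-r) r) → (∀ i, w i ∈ Icc (-r) r ×ˢ Icc (-r) r) →
      ∀ M : ℝ, (∀ i, dist (hypCoord R (z i)) (hypCoord R (w i)) ≤ M) →
      ∀ i, dist (hypCoord R (T z i)) (hypCoord R (T w i)) ≤ κ * M) :
    ∃! z : I → ℝ × ℝ, (∀ i, z i ∈ Icc (-r) r ×ˢ Icc (-r) r) ∧ T z = z := by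
  have hR : 0 < R := hr.trans hrR
  set Θ := Real.artanh (r / R) with hΘ
  have hbound : ∀ {u v : ℝ × ℝ}, u ∈ Icc (-r) r ×ˢ Icc (-r) r → v ∈ Icc (-r) r ×ˢ Icc (-r) r →
      dist (hypCoord R u) (hypCoord R v) ≤ Θ + Θ := fun {u v} hu hv =>
    (dist_le_norm_add_norm _ _).trans
      (add_le_add (norm_hypCoord_le hr hrR hu) (norm_hypCoord_le hr hrR hv))
  refine existsUnique_of_exists_of_unique ?_ ?_
  · have hΘ0 : 0 ≤ Θ := (norm_nonneg _).trans (norm_hypCoord_le hr hrR (u := (0, 0))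
      ⟨⟨by linarith, hr.le⟩, ⟨by linarith, hr.le⟩⟩)
    have hmem : ∀ {θ : ℝ × ℝ}, θ ∈ Metric.closedBall (0 : ℝ × ℝ) Θ →
        hypPoint R θ ∈ Icc (-r) r ×ˢ Icc (-r) r := fun {θ} h =>
      hypPoint_mem hr hrR (mem_closedBall_zero_iff.1 h)
    obtain ⟨θ, hθ, hfix⟩ := exists_fixedPoint_of_sup_contraction (I := I)
      (D := Metric.closedBall (0 : ℝ × ℝ) Θ) Metric.isClosed_closedBall
      (fun θ i => hypCoord R (T (fun j => hypPoint R (θ j)) i)) hκ0 hκ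
      (fun θ hθ i => mem_closedBall_zero_iff.2
        (norm_hypCoord_le hr hrR (hT _ (fun j => hmem (hθ j)) i)))
      (fun θ φ hθ hφ M hM i => hc _ _ (fun j => hmem (hθ j)) (fun j => hmem (hφ j)) M
        (fun j => by simpa only [hypCoord_hypPoint hR] using hM j) i)
      (fun _ => 0) (fun _ => Metric.mem_closedBall_self hΘ0) (C := Θ) (fun i => by
        rw [dist_zero_left]
        exact norm_hypCoord_le hr hrR
          (hT _ (fun j => hmem (Metric.mem_closedBall_self hΘ0)) i))
    refine ⟨fun i => hypPoint R (θ i), fun i => hmem (hθ i), funext fun i => ?_⟩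
    have h1 := congrArg (hypPoint R) (congrFun hfix i)
    rwa [hypPoint_hypCoord hr hrR (hT _ (fun j => hmem (hθ j)) i)] at h1
  · rintro z w ⟨hz, hzT⟩ ⟨hw, hwT⟩
    have hn : ∀ n : ℕ, ∀ i, dist (hypCoord R (z i)) (hypCoord R (w i)) ≤ κ ^ n * (Θ + Θ) := by
      intro n
      induction n with
      | zero => intro i; simpa using hbound (hz i) (hw i)
      | succ n ih =>
        intro i
        have := hc z w hz hw _ ih i
        rw [hzT, hwT] at this
        exact this.trans_eq (by ring)
    funext i
    have h0 : dist (hypCoord R (z i)) (hypCoord R (w i)) ≤ 0 :=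
      ge_of_tendsto' (by simpa using
        (tendsto_pow_atTop_nhds_zero_of_lt_one hκ0 hκ).mul_const (Θ + Θ)) fun n => hn n i
    rw [← hypPoint_hypCoord hr hrR (hz i), ← hypPoint_hypCoord hr hrR (hw i),
      dist_le_zero.1 h0]

/-! ### The orbit recursion -/

/-- The sum `g u` of the two neighbours of `u` along an orbit `…, v, u, w, …` of the coupled Hénon
map regarded as the second order recursion `w + v = g u`. -/
def neighbourSum (a : Fin 2 → ℝ) (c : ℝ) (u : ℝ × ℝ) : ℝ × ℝ :=
  (a 0 - u.1 ^ 2 + c * (u.1 - u.2), a 1 - u.2 ^ 2 - c * (u.1 - u.2))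

/-- The point `u` lies in the quadrant with centre `(c / 2, c / 2)` named by the signs `s`. -/
def InQuadrant (c : ℝ) (s : Bool × Bool) (u : ℝ × ℝ) : Prop :=
  0 ≤ boolSign s.1 * (u.1 - c / 2) ∧ 0 ≤ boolSign s.2 * (u.2 - c / 2)

/-- Solving each component of `w + v = g u` for the variable that occurs quadratically, with
the signs `s` for the roots, gives the fixed-point equation `u = pairBranch a c s u w v`. -/
noncomputable def pairBranch (a : Fin 2 → ℝ) (c : ℝ) (s : Bool × Bool) (u w v : ℝ × ℝ) : ℝ × ℝ :=
  (henonBranch (boolSign s.1) (c ^ 2 / 4 + a 0) c u.2 w.1 v.1,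
   henonBranch (boolSign s.2) (c ^ 2 / 4 + a 1) c u.1 w.2 v.2)

theorem eq_henonBranch_iff {b c ε x x₁ x₂ x₃ : ℝ} (hε : ε = 1 ∨ ε = -1)
    (hpos : 0 < b - c * x₁ - x₂ - x₃) :
    x = henonBranch ε b c x₁ x₂ x₃ ↔
      0 ≤ ε * (x - c / 2) ∧ (x - c / 2) ^ 2 = b - c * x₁ - x₂ - x₃ := by
  have hS := Real.sq_sqrt hpos.le
  have hS0 := Real.sqrt_nonneg (b - c * x₁ - x₂ - x₃)
  have hεε : ε * ε = 1 := by rcases hε with rfl | rfl <;> norm_num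
  constructor
  · rintro rfl
    simp only [henonBranch, add_sub_cancel_left]
    refine ⟨by rw [← mul_assoc, hεε, one_mul]; exact hS0, ?_⟩
    rw [mul_pow, hS, pow_two, hεε, one_mul]
  · rintro ⟨h0, h2⟩
    have : ε * (x - c / 2) = √(b - c * x₁ - x₂ - x₃) := by
      rw [← h2, ← Real.sqrt_sq h0, mul_pow, pow_two ε, hεε, one_mul]
    rw [henonBranch, ← this, ← mul_assoc, hεε]
    ring

section
variable {a : Fin 2 → ℝ} {c r R : ℝ}

theorem root_arg_pos (hB : ∀ i, IsBranchBox c (c ^ 2 / 4 + a i) r R) (i : Fin 2) {x₁ x₂ x₃ : ℝ}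
    (h₁ : x₁ ∈ Icc (-r) r) (h₂ : x₂ ∈ Icc (-r) r) (h₃ : x₃ ∈ Icc (-r) r) :
    0 < c ^ 2 / 4 + a i - c * x₁ - x₂ - x₃ := by
  have hs := weighted_sum_mem (hB i).c_pos h₁ h₂ h₃
  have hc := (hB i).c_pos
  have : (c + 2) * r < (c + 2) * R := mul_lt_mul_of_pos_left (hB i).r_lt (by linarith)
  linarith [hs.2, (hB i).root_pos]

theorem eq_pairBranch_iff (hB : ∀ i, IsBranchBox c (c ^ 2 / 4 + a i) r R) (s : Bool × Bool)
    {u w v : ℝ × ℝ} (hu : u ∈ Icc (-r) r ×ˢ Icc (-r) r) (hw : w ∈ Icc (-r) r ×ˢ Icc (-r) r)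
    (hv : v ∈ Icc (-r) r ×ˢ Icc (-r) r) :
    u = pairBranch a c s u w v ↔ InQuadrant c s u ∧ neighbourSum a c u = w + v := by
  have h1 := eq_henonBranch_iff (x := u.1) (boolSign_eq s.1) (root_arg_pos hB 0 hu.2 hw.1 hv.1)
  have h2 := eq_henonBranch_iff (x := u.2) (boolSign_eq s.2) (root_arg_pos hB 1 hu.1 hw.2 hv.2)
  rw [pairBranch, Prod.ext_iff, h1, h2, Prod.ext_iff]
  simp only [InQuadrant, neighbourSum, Prod.fst_add, Prod.snd_add]
  constructor
  · rintro ⟨⟨p1, q1⟩, p2, q2⟩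
    exact ⟨⟨p1, p2⟩, by linarith, by linarith⟩
  · rintro ⟨⟨p1, p2⟩, q1, q2⟩
    exact ⟨⟨p1, by linarith⟩, p2, by linarith⟩

theorem pairBranch_mem (hB : ∀ i, IsBranchBox c (c ^ 2 / 4 + a i) r R) (s : Bool × Bool)
    {u w v : ℝ × ℝ} (hu : u ∈ Icc (-r) r ×ˢ Icc (-r) r) (hw : w ∈ Icc (-r) r ×ˢ Icc (-r) r)
    (hv : v ∈ Icc (-r) r ×ˢ Icc (-r) r) :
    pairBranch a c s u w v ∈ Icc (-r) r ×ˢ Icc (-r) r :=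
  ⟨(hB 0).branch_mem (boolSign_eq _) hu.2 hw.1 hv.1,
    (hB 1).branch_mem (boolSign_eq _) hu.1 hw.2 hv.2⟩

theorem dist_pairBranch_le (hB : ∀ i, IsBranchBox c (c ^ 2 / 4 + a i) r R) (s : Bool × Bool)
    {u w v u' w' v' : ℝ × ℝ} {M : ℝ}
    (hu : u ∈ Icc (-r) r ×ˢ Icc (-r) r) (hw : w ∈ Icc (-r) r ×ˢ Icc (-r) r)
    (hv : v ∈ Icc (-r) r ×ˢ Icc (-r) r)
    (hu' : u' ∈ Icc (-r) r ×ˢ Icc (-r) r) (hw' : w' ∈ Icc (-r) r ×ˢ Icc (-r) r)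
    (hv' : v' ∈ Icc (-r) r ×ˢ Icc (-r) r)
    (h₁ : dist (hypCoord R u) (hypCoord R u') ≤ M) (h₂ : dist (hypCoord R w) (hypCoord R w') ≤ M)
    (h₃ : dist (hypCoord R v) (hypCoord R v') ≤ M) :
    dist (hypCoord R (pairBranch a c s u w v)) (hypCoord R (pairBranch a c s u' w' v')) ≤
      max (branchFactor c (c ^ 2 / 4 + a 0) r R) (branchFactor c (c ^ 2 / 4 + a 1) r R) * M := by
  have hr : 0 < r := by linarith [(hB 0).c_pos, (hB 0).c_lt]
  have hrR := (hB 0).r_lt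
  have hM : 0 ≤ M := dist_nonneg.trans h₁
  rw [Prod.dist_eq, max_le_iff] at h₁ h₂ h₃
  have hb : ∀ {x : ℝ}, x ∈ Icc (-r) r → |Real.artanh (x / R)| ≤ Real.artanh (r / R) :=
    fun hx => (artanh_scaled_mem hr hrR hx).2
  have ht : ∀ {x : ℝ}, x ∈ Icc (-r) r → R * Real.tanh (Real.artanh (x / R)) = x := fun hx => by
    rw [Real.tanh_artanh (artanh_scaled_mem hr hrR hx).1]
    have : 0 < R := hr.trans hrR
    field_simp
  rw [Prod.dist_eq, max_le_iff]
  constructor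
  · have := (hB 0).dist_branch_le (boolSign_eq s.1) (hb hu'.2) (hb hw'.1) (hb hv'.1)
      (hb hu.2) (hb hw.1) (hb hv.1) h₁.2 h₂.1 h₃.1
    rw [ht hu.2, ht hw.1, ht hv.1, ht hu'.2, ht hw'.1, ht hv'.1] at this
    exact this.trans (mul_le_mul_of_nonneg_right (le_max_left _ _) hM)
  · have := (hB 1).dist_branch_le (boolSign_eq s.2) (hb hu'.1) (hb hw'.2) (hb hv'.2)
      (hb hu.1) (hb hw.2) (hb hv.2) h₁.1 h₂.2 h₃.2
    rw [ht hu.1, ht hw.2, ht hv.2, ht hu'.1, ht hw'.2, ht hv'.2] at this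
    exact this.trans (mul_le_mul_of_nonneg_right (le_max_right _ _) hM)

theorem pairFactor_mem (hB : ∀ i, IsBranchBox c (c ^ 2 / 4 + a i) r R) :
    max (branchFactor c (c ^ 2 / 4 + a 0) r R) (branchFactor c (c ^ 2 / 4 + a 1) r R) ∈
      Ico (0 : ℝ) 1 :=
  ⟨(hB 0).factor_mem.1.trans (le_max_left _ _), max_lt (hB 0).factor_mem.2 (hB 1).factor_mem.2⟩

/-- Between two prescribed neighbours there is exactly one point in each quadrant. -/
theorem existsUnique_middle (hB : ∀ i, IsBranchBox c (c ^ 2 / 4 + a i) r R) (s : Bool × Bool)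
    {w v : ℝ × ℝ} (hw : w ∈ Icc (-r) r ×ˢ Icc (-r) r) (hv : v ∈ Icc (-r) r ×ˢ Icc (-r) r) :
    ∃! u : ℝ × ℝ, u ∈ Icc (-r) r ×ˢ Icc (-r) r ∧ InQuadrant c s u ∧
      neighbourSum a c u = w + v := by
  have hr : 0 < r := by linarith [(hB 0).c_pos, (hB 0).c_lt]
  obtain ⟨z, ⟨hz, hzT⟩, huniq⟩ := existsUnique_fixedPoint_of_hyp_contraction (I := Unit) hr
    (hB 0).r_lt (pairFactor_mem hB).1 (pairFactor_mem hB).2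
    (fun z i => pairBranch a c s (z i) w v)
    (fun z hz i => pairBranch_mem hB s (hz i) hw hv)
    (fun z z' hz hz' M hM i => dist_pairBranch_le hB s (hz i) hw hv (hz' i) hw hv (hM i)
      (by rw [dist_self]; exact dist_nonneg.trans (hM i))
      (by rw [dist_self]; exact dist_nonneg.trans (hM i)))
  refine ⟨z (), ⟨hz (), (eq_pairBranch_iff hB s (hz ()) hw hv).1 (congrFun hzT ()).symm⟩, ?_⟩
  rintro u ⟨hu, hu'⟩
  exact congrFun (huniq (fun _ => u)
    ⟨fun _ => hu, funext fun _ => ((eq_pairBranch_iff hB s hu hw hv).2 hu').symm⟩) ()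

/-- Every bi-infinite sequence of quadrants is realised by an orbit in the square. -/
theorem exists_orbit_of_itinerary (hB : ∀ i, IsBranchBox c (c ^ 2 / 4 + a i) r R)
    (s : ℤ → Bool × Bool) :
    ∃ z : ℤ → ℝ × ℝ, ∀ n, z n ∈ Icc (-r) r ×ˢ Icc (-r) r ∧ InQuadrant c (s n) (z n) ∧
      neighbourSum a c (z n) = z (n + 1) + z (n - 1) := by
  have hr : 0 < r := by linarith [(hB 0).c_pos, (hB 0).c_lt]
  obtain ⟨z, ⟨hz, hzT⟩, -⟩ := existsUnique_fixedPoint_of_hyp_contraction (I := ℤ) hr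
    (hB 0).r_lt (pairFactor_mem hB).1 (pairFactor_mem hB).2
    (fun z n => pairBranch a c (s n) (z n) (z (n + 1)) (z (n - 1)))
    (fun z hz n => pairBranch_mem hB _ (hz _) (hz _) (hz _))
    (fun z z' hz hz' M hM i => dist_pairBranch_le hB _ (hz _) (hz _) (hz _) (hz' _) (hz' _) (hz' _)
      (hM _) (hM _) (hM _))
  exact ⟨z, fun n => ⟨hz n, (eq_pairBranch_iff hB _ (hz _) (hz _) (hz _)).1
    (congrFun hzT n).symm⟩⟩

end

/-! ### The non-wandering set -/

section
variable {X Y : Type*} [TopologicalSpace X] [TopologicalSpace Y]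

theorem isClosed_nonwanderingSet (f : X → X) : IsClosed (nonwanderingSet f) := by
  rw [← isOpen_compl_iff, isOpen_iff_mem_nhds]
  intro x hx
  simp only [nonwanderingSet, mem_compl_iff, mem_ofPred_eq, not_forall] at hx
  obtain ⟨U, hU, hn⟩ := hx
  filter_upwards [eventually_mem_nhds_iff.2 hU] with y hy hmem
  exact hn (hmem U hy)

/-- A homeomorphism conjugating `f` to `g` carries non-wandering points to non-wandering points. -/
theorem mem_nonwanderingSet_of_semiconj (h : X ≃ₜ Y) {f : X → X} {g : Y → Y}
    (hfg : Function.Semiconj h f g) {x : X} (hx : x ∈ nonwanderingSet f) :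
    h x ∈ nonwanderingSet g := by
  intro U hU
  obtain ⟨n, hn, _, ⟨y, hy, rfl⟩, hz⟩ := hx (h ⁻¹' U) (h.continuous.continuousAt.preimage_mem_nhds hU)
  exact ⟨n, hn, h (f^[n] y), ⟨h y, hy, ((hfg.iterate_right n) y).symm⟩, hz⟩

theorem nonwanderingSet_symm (f : X ≃ₜ X) : nonwanderingSet f.symm = nonwanderingSet f := by
  have key : ∀ f : X ≃ₜ X, nonwanderingSet f ⊆ nonwanderingSet f.symm := by
    intro f x hx U hU
    obtain ⟨n, hn, _, ⟨y, hy, rfl⟩, hz⟩ := hx U hU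
    refine ⟨n, hn, y, ⟨_, hz, ?_⟩, hy⟩
    exact (Function.LeftInverse.iterate f.symm_apply_apply n) y
  exact Subset.antisymm (key f.symm) (key f)

theorem image_nonwanderingSet (f : X ≃ₜ X) : f '' nonwanderingSet f = nonwanderingSet f := by
  apply Subset.antisymm
  · rintro _ ⟨x, hx, rfl⟩
    exact mem_nonwanderingSet_of_semiconj f (fun _ => rfl) hx
  · intro x hx
    exact ⟨f.symm x, mem_nonwanderingSet_of_semiconj f.symm (fun y => by simp) hx,
      f.apply_symm_apply x⟩

/-- A point that enters a forward invariant open set on which `φ` does not increase, and loses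
height `φ` on entering it, is wandering. -/
theorem notMem_nonwanderingSet_of_descent {f : X → X} (hf : Continuous f) {φ : X → ℝ}
    (hφ : Continuous φ) {O : Set X} (hO : IsOpen O) (hfO : MapsTo f O O)
    (hφO : ∀ q ∈ O, φ (f q) ≤ φ q) {p : X} (hp : f p ∈ O) (hlt : φ (f p) < φ p) :
    p ∉ nonwanderingSet f := by
  intro hmem
  obtain ⟨m, hm1, hm2⟩ := exists_between hlt
  have hU : {q | m < φ q} ∩ ({q | φ (f q) < m} ∩ f ⁻¹' O) ∈ 𝓝 p :=
    (((isOpen_lt continuous_const hφ).inter ((isOpen_lt (hφ.comp hf) continuous_const).inter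
      (hO.preimage hf)))).mem_nhds ⟨hm2, hm1, hp⟩
  obtain ⟨n, hn, _, ⟨q, ⟨-, hq2, hq3⟩, rfl⟩, hz, -⟩ := hmem _ hU
  obtain ⟨k, rfl⟩ : ∃ k, n = k + 1 := ⟨n - 1, by omega⟩
  have hk : ∀ k, f^[k + 1] q ∈ O ∧ φ (f^[k + 1] q) < m := by
    intro k
    induction k with
    | zero => exact ⟨hq3, hq2⟩
    | succ k ih =>
      rw [Function.iterate_succ_apply']
      exact ⟨hfO ih.1, (hφO _ ih.1).trans_lt ih.2⟩
  exact lt_asymm (hk k).2 hz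

end

/-! ### The non-wandering set of the coupled Hénon map is bounded -/

/-- The time-reversing symmetry `(u, v) ↦ (v, u)` of the coupled Hénon map. -/
def phaseSwap : Phase ≃ₜ Phase := Homeomorph.prodComm _ _

theorem coupledHenon_apply (a : Fin 2 → ℝ) (c : ℝ) (p : Phase) :
    coupledHenon a c p = (neighbourSum a c p.1 - p.2, p.1) := by
  change ((a 0 - p.1.1 ^ 2 - p.2.1 + c * (p.1.1 - p.1.2),
    a 1 - p.1.2 ^ 2 - p.2.2 - c * (p.1.1 - p.1.2)), (p.1.1, p.1.2)) = _
  ext <;> simp only [neighbourSum, Prod.fst_sub, Prod.snd_sub]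
  · ring
  · ring

theorem coupledHenon_symm_apply (a : Fin 2 → ℝ) (c : ℝ) (p : Phase) :
    (coupledHenon a c).symm p = (p.2, neighbourSum a c p.2 - p.1) := by
  rw [Homeomorph.symm_apply_eq, coupledHenon_apply]
  simp

theorem coupledHenon_symm_eq (a : Fin 2 → ℝ) (c : ℝ) (p : Phase) :
    (coupledHenon a c).symm p = phaseSwap (coupledHenon a c (phaseSwap p)) := by
  rw [coupledHenon_symm_apply, coupledHenon_apply]
  rfl

theorem semiconj_phaseSwap (a : Fin 2 → ℝ) (c : ℝ) :
    Function.Semiconj phaseSwap (coupledHenon a c) (coupledHenon a c).symm := fun p => by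
  rw [coupledHenon_symm_eq]
  rfl

theorem swap_mem_nonwanderingSet {a : Fin 2 → ℝ} {c : ℝ} {p : Phase}
    (hp : p ∈ nonwanderingSet (coupledHenon a c)) :
    phaseSwap p ∈ nonwanderingSet (coupledHenon a c) := by
  rw [← nonwanderingSet_symm]
  exact mem_nonwanderingSet_of_semiconj phaseSwap (semiconj_phaseSwap a c) hp

section
variable {a : Fin 2 → ℝ} {c R : ℝ}

/-- Left of `-2R` the mean coordinate `x + y` is concave along orbits. Here `R` is the escape radius
of the one-dimensional Hénon recursion with parameter `(a₀ + a₁) / 2`. -/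
theorem neighbourSum_sum_lt (hR : 1 ≤ R) (hA : (a 0 + a 1) / 2 = R ^ 2 - 2 * R) {u : ℝ × ℝ}
    (hu : u.1 + u.2 < -(2 * R)) :
    (neighbourSum a c u).1 + (neighbourSum a c u).2 < 2 * (u.1 + u.2) := by
  have h1 : (neighbourSum a c u).1 + (neighbourSum a c u).2 =
      2 * (R ^ 2 - 2 * R) - (u.1 ^ 2 + u.2 ^ 2) := by
    simp only [neighbourSum]; linarith
  rw [h1]
  nlinarith [sq_nonneg (u.1 - u.2)]

theorem notMem_nonwanderingSet_of_escape (hR : 1 ≤ R) (hA : (a 0 + a 1) / 2 = R ^ 2 - 2 * R)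
    {p : Phase} (h₁ : p.1.1 + p.1.2 < -(2 * R)) (h₂ : p.1.1 + p.1.2 ≤ p.2.1 + p.2.2) :
    p ∉ nonwanderingSet (coupledHenon a c) := by
  have step : ∀ q : Phase, q.1.1 + q.1.2 < -(2 * R) → q.1.1 + q.1.2 ≤ q.2.1 + q.2.2 →
      (coupledHenon a c q).1.1 + (coupledHenon a c q).1.2 < q.1.1 + q.1.2 := by
    intro q h₁ h₂
    have := neighbourSum_sum_lt (c := c) hR hA h₁
    rw [coupledHenon_apply]
    simp only [Prod.fst_sub, Prod.snd_sub]
    linarith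
  have mem : ∀ q : Phase, q.1.1 + q.1.2 < -(2 * R) → q.1.1 + q.1.2 ≤ q.2.1 + q.2.2 →
      coupledHenon a c q ∈
        {q : Phase | q.1.1 + q.1.2 < -(2 * R) ∧ q.1.1 + q.1.2 < q.2.1 + q.2.2} :=
    fun q h₁ h₂ => ⟨(step q h₁ h₂).trans h₁, step q h₁ h₂⟩
  have hopen : IsOpen {q : Phase | q.1.1 + q.1.2 < -(2 * R) ∧ q.1.1 + q.1.2 < q.2.1 + q.2.2} := by
    have h₁ : IsOpen {q : Phase | q.1.1 + q.1.2 < -(2 * R)} :=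
      isOpen_lt (by fun_prop) (by fun_prop)
    have h₂ : IsOpen {q : Phase | q.1.1 + q.1.2 < q.2.1 + q.2.2} :=
      isOpen_lt (by fun_prop) (by fun_prop)
    exact h₁.inter h₂
  refine notMem_nonwanderingSet_of_descent (coupledHenon a c).continuous
    (φ := fun q : Phase => q.1.1 + q.1.2) (by fun_prop)
    (O := {q : Phase | q.1.1 + q.1.2 < -(2 * R) ∧ q.1.1 + q.1.2 < q.2.1 + q.2.2}) hopen
    (fun q hq => mem q hq.1 hq.2.le) (fun q hq => (step q hq.1 hq.2.le).le)
    (mem p h₁ h₂) (step p h₁ h₂)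

theorem sum_ge_of_mem_nonwanderingSet (hR : 1 ≤ R) (hA : (a 0 + a 1) / 2 = R ^ 2 - 2 * R)
    {p : Phase} (hp : p ∈ nonwanderingSet (coupledHenon a c)) :
    -(2 * R) ≤ p.1.1 + p.1.2 ∧ -(2 * R) ≤ p.2.1 + p.2.2 := by
  have h1 := fun h₁ h₂ => notMem_nonwanderingSet_of_escape (c := c) hR hA (p := p) h₁ h₂ hp
  have h2 := fun h₁ h₂ => notMem_nonwanderingSet_of_escape (c := c) hR hA (p := phaseSwap p) h₁ h₂
    (swap_mem_nonwanderingSet hp)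
  have e1 : (phaseSwap p).1 = p.2 := rfl
  have e2 : (phaseSwap p).2 = p.1 := rfl
  rw [e1, e2] at h2
  constructor
  · by_contra! h
    by_cases h' : p.1.1 + p.1.2 ≤ p.2.1 + p.2.2
    · exact h1 h h'
    · exact h2 (by linarith) (by linarith)
  · by_contra! h
    by_cases h' : p.2.1 + p.2.2 ≤ p.1.1 + p.1.2
    · exact h2 h h'
    · exact h1 (by linarith) (by linarith)

theorem sq_add_sq_le_of_mem_nonwanderingSet (hR : 1 ≤ R)
    (hA : (a 0 + a 1) / 2 = R ^ 2 - 2 * R) {p : Phase}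
    (hp : p ∈ nonwanderingSet (coupledHenon a c)) :
    p.1.1 ^ 2 + p.1.2 ^ 2 ≤ 2 * R ^ 2 := by
  have h1 := (sum_ge_of_mem_nonwanderingSet hR hA hp).2
  have h2 := (sum_ge_of_mem_nonwanderingSet hR hA
    (image_nonwanderingSet (coupledHenon a c) ▸ mem_image_of_mem _ hp)).1
  rw [coupledHenon_apply] at h2
  simp only [Prod.fst_sub, Prod.snd_sub, neighbourSum] at h2
  nlinarith

/-- The non-wandering set lies in the box of half-width `2 √2 R` (in fact in that of half-width
`√2 R`). -/
theorem nonwanderingSet_subset_box (hR : 1 ≤ R) (hA : (a 0 + a 1) / 2 = R ^ 2 - 2 * R) :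
    nonwanderingSet (coupledHenon a c) ⊆
      (Icc (-(2 * √2 * R)) (2 * √2 * R) ×ˢ Icc (-(2 * √2 * R)) (2 * √2 * R)) ×ˢ
        (Icc (-(2 * √2 * R)) (2 * √2 * R) ×ˢ Icc (-(2 * √2 * R)) (2 * √2 * R)) := by
  intro p hp
  have key : ∀ x y : ℝ, x ^ 2 + y ^ 2 ≤ 2 * R ^ 2 →
      x ∈ Icc (-(2 * √2 * R)) (2 * √2 * R) := by
    intro x y h
    have h2 : (2 * √2 * R) ^ 2 = 8 * R ^ 2 := by
      rw [mul_pow, mul_pow, Real.sq_sqrt zero_le_two]; ring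
    exact abs_le.1 (abs_le_of_sq_le_sq (by rw [h2]; nlinarith [sq_nonneg y]) (by positivity))
  have h1 := sq_add_sq_le_of_mem_nonwanderingSet hR hA hp
  have h2 := sq_add_sq_le_of_mem_nonwanderingSet hR hA (swap_mem_nonwanderingSet hp)
  have e1 : (phaseSwap p).1 = p.2 := rfl
  rw [e1] at h2
  exact ⟨⟨key _ _ h1, key _ _ (by rw [add_comm]; exact h1)⟩,
    ⟨key _ _ h2, key _ _ (by rw [add_comm]; exact h2)⟩⟩

end

/-! ### The horseshoe -/

/-- A compact set that a continuous map carries bijectively onto a connected set is connected. -/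
theorem IsCompact.isConnected_of_bijOn {X Y : Type*} [TopologicalSpace X] [TopologicalSpace Y]
    [T2Space Y] {K : Set X} {L : Set Y} {ψ : X → Y} (hK : IsCompact K) (hψ : ContinuousOn ψ K)
    (hb : BijOn ψ K L) (hL : IsConnected L) : IsConnected K := by
  have := isCompact_iff_compactSpace.1 hK
  have := isConnected_iff_connectedSpace.1 hL
  have hcont : Continuous (hb.equiv ψ) := hψ.mapsToRestrict hb.mapsTo
  let h : K ≃ₜ L := Continuous.homeoOfEquivCompactToT2 hcont
  exact isConnected_iff_connectedSpace.2 (h.symm.surjective.connectedSpace h.symm.continuous)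

/-- The component of `f(V) ∩ V` named by the signs `s`, for the coupled Hénon map `f` and the box
`V` of half-width `r`: the pairs `(w, u)` in `V` with `f⁻¹ (w, u)` in `V` and `u` in the quadrant
`s`. -/
def horseshoePiece (a : Fin 2 → ℝ) (c r : ℝ) (s : Bool × Bool) : Set Phase :=
  {p | p.1 ∈ Icc (-r) r ×ˢ Icc (-r) r ∧ p.2 ∈ Icc (-r) r ×ˢ Icc (-r) r ∧
    neighbourSum a c p.2 - p.1 ∈ Icc (-r) r ×ˢ Icc (-r) r ∧ InQuadrant c s p.2}

section
variable {a : Fin 2 → ℝ} {c r R : ℝ}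

theorem continuous_neighbourSum : Continuous (neighbourSum a c) := by
  unfold neighbourSum
  fun_prop

theorem isCompact_horseshoePiece (s : Bool × Bool) : IsCompact (horseshoePiece a c r s) := by
  have hsq : IsCompact (Icc (-r) r ×ˢ Icc (-r) r : Set (ℝ × ℝ)) := isCompact_Icc.prod isCompact_Icc
  have hcl : IsClosed {p : Phase | neighbourSum a c p.2 - p.1 ∈ Icc (-r) r ×ˢ Icc (-r) r ∧
      InQuadrant c s p.2} := by
    have h1 : IsClosed {p : Phase | neighbourSum a c p.2 - p.1 ∈ Icc (-r) r ×ˢ Icc (-r) r} :=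
      hsq.isClosed.preimage ((continuous_neighbourSum.comp continuous_snd).sub continuous_fst)
    have h2 : IsClosed {p : Phase | 0 ≤ boolSign s.1 * (p.2.1 - c / 2)} :=
      isClosed_le (by fun_prop) (by fun_prop)
    have h3 : IsClosed {p : Phase | 0 ≤ boolSign s.2 * (p.2.2 - c / 2)} :=
      isClosed_le (by fun_prop) (by fun_prop)
    exact h1.inter (h2.inter h3)
  convert (hsq.prod hsq).inter_right hcl using 1
  ext p
  simp only [horseshoePiece, mem_inter_iff, mem_prod, mem_ofPred_eq]
  tauto

theorem mem_piece_of_preimage {s : Bool × Bool} {p : Phase} :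
    coupledHenon a c p ∈ horseshoePiece a c r s ↔
      neighbourSum a c p.1 - p.2 ∈ Icc (-r) r ×ˢ Icc (-r) r ∧ p.1 ∈ Icc (-r) r ×ˢ Icc (-r) r ∧
        p.2 ∈ Icc (-r) r ×ˢ Icc (-r) r ∧ InQuadrant c s p.1 := by
  rw [coupledHenon_apply]
  simp only [horseshoePiece, mem_ofPred_eq, sub_sub_cancel]

theorem exists_inQuadrant (u : ℝ × ℝ) : ∃ s, InQuadrant c s u := by
  have h : ∀ x : ℝ, ∃ b, 0 ≤ boolSign b * (x - c / 2) := by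
    intro x
    rcases le_total 0 (x - c / 2) with h | h
    · exact ⟨true, by simpa [boolSign] using h⟩
    · exact ⟨false, by simpa [boolSign] using h⟩
  obtain ⟨b, hb⟩ := h u.1
  obtain ⟨b', hb'⟩ := h u.2
  exact ⟨(b, b'), hb, hb'⟩

theorem iUnion_horseshoePiece :
    ⋃ s, horseshoePiece a c r s =
      coupledHenon a c '' ((Icc (-r) r ×ˢ Icc (-r) r) ×ˢ (Icc (-r) r ×ˢ Icc (-r) r)) ∩
        (Icc (-r) r ×ˢ Icc (-r) r) ×ˢ (Icc (-r) r ×ˢ Icc (-r) r) := by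
  ext p
  rw [← Homeomorph.preimage_symm]
  simp only [mem_iUnion, mem_inter_iff, mem_preimage, coupledHenon_symm_apply, horseshoePiece,
    mem_ofPred_eq]
  constructor
  · rintro ⟨s, h1, h2, h3, -⟩
    exact ⟨⟨h2, h3⟩, h1, h2⟩
  · rintro ⟨⟨-, h3⟩, h1, h2⟩
    obtain ⟨s, hs⟩ := exists_inQuadrant (c := c) p.2
    exact ⟨s, h1, h2, h3, hs⟩

/-- Points of the square whose neighbours lie in the square stay off the lines `x = c / 2` and
`y = c / 2`, so they lie in a single quadrant. -/
theorem inQuadrant_unique (hB : ∀ i, IsBranchBox c (c ^ 2 / 4 + a i) r R) {u w v : ℝ × ℝ}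
    (hu : u ∈ Icc (-r) r ×ˢ Icc (-r) r) (hw : w ∈ Icc (-r) r ×ˢ Icc (-r) r)
    (hv : v ∈ Icc (-r) r ×ˢ Icc (-r) r) (h : neighbourSum a c u = w + v) {s t : Bool × Bool}
    (hs : InQuadrant c s u) (ht : InQuadrant c t u) : s = t := by
  have key : ∀ {b b' : Bool} {x : ℝ}, 0 < x ^ 2 → 0 ≤ boolSign b * x → 0 ≤ boolSign b' * x →
      b = b' := by
    intro b b' x hx h1 h2
    have hx0 : x ≠ 0 := by rintro rfl; simp at hx
    cases b <;> cases b' <;> simp [boolSign] at h1 h2 ⊢ <;> exact hx0 (le_antisymm ‹_› ‹_›)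
  have p0 := root_arg_pos hB 0 hu.2 hw.1 hv.1
  have p1 := root_arg_pos hB 1 hu.1 hw.2 hv.2
  simp only [neighbourSum, Prod.ext_iff, Prod.fst_add, Prod.snd_add] at h
  exact Prod.ext (key (by nlinarith [h.1]) hs.1 ht.1) (key (by nlinarith [h.2]) hs.2 ht.2)

theorem disjoint_horseshoePiece (hB : ∀ i, IsBranchBox c (c ^ 2 / 4 + a i) r R) :
    Pairwise fun s t => Disjoint (horseshoePiece a c r s) (horseshoePiece a c r t) := by
  intro s t hst
  rw [Set.disjoint_left]
  rintro p ⟨h1, h2, h3, hs⟩ ⟨-, -, -, ht⟩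
  exact hst (inQuadrant_unique hB h2 h1 h3 (by abel) hs ht)

theorem isConnected_horseshoePiece (hB : ∀ i, IsBranchBox c (c ^ 2 / 4 + a i) r R)
    (s : Bool × Bool) : IsConnected (horseshoePiece a c r s) := by
  have hr : 0 < r := by linarith [(hB 0).c_pos, (hB 0).c_lt]
  have hI : IsConnected (Icc (-r) r) := isConnected_Icc (by linarith)
  refine (isCompact_horseshoePiece s).isConnected_of_bijOn
    (ψ := fun p => (p.1, neighbourSum a c p.2 - p.1)) ?_ ?_ ((hI.prod hI).prod (hI.prod hI))
  · exact (continuous_fst.prodMk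
      ((continuous_neighbourSum.comp continuous_snd).sub continuous_fst)).continuousOn
  · refine ⟨fun p hp => ⟨hp.1, hp.2.2.1⟩, ?_, ?_⟩
    · rintro ⟨w, u⟩ ⟨h1, h2, h3, h4⟩ ⟨w', u'⟩ ⟨-, h2', -, h4'⟩ he
      simp only [Prod.mk.injEq] at he h1 h2 h3 h4 h2' h4'
      obtain ⟨rfl, he⟩ := he
      rw [(existsUnique_middle hB s h1 h3).unique ⟨h2, h4, by abel⟩ ⟨h2', h4', by rw [he]; abel⟩]
    · rintro ⟨w, v⟩ ⟨hw, hv⟩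
      obtain ⟨u, ⟨h1, h2, h3⟩, -⟩ := existsUnique_middle hB s hw hv
      refine ⟨(w, u), ⟨hw, h1, ?_, h2⟩, ?_⟩
      · simpa [h3] using hv
      · simp [h3]

theorem mem_interior_of_neighbours (hB : ∀ i, IsBranchBox c (c ^ 2 / 4 + a i) r R)
    (h2 : ∀ i, 0 ≤ r ^ 2 - 2 * (c + 1) * r - a i) {u w v : ℝ × ℝ}
    (hu : u ∈ Icc (-r) r ×ˢ Icc (-r) r) (hw : w ∈ Icc (-r) r ×ˢ Icc (-r) r)
    (hv : v ∈ Icc (-r) r ×ˢ Icc (-r) r) (h : neighbourSum a c u = w + v) :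
    u ∈ interior (Icc (-r) r ×ˢ Icc (-r) r) := by
  have hc := (hB 0).c_pos
  have hr : 0 < r := by linarith [(hB 0).c_lt]
  have hcr : 0 < c * r := mul_pos hc hr
  -- at a right end the first equation forces the other coordinate to the left end, where the
  -- second equation fails
  have key : ∀ {α β x y e e' : ℝ}, 0 ≤ r ^ 2 - 2 * (c + 1) * r - α →
      0 ≤ r ^ 2 - 2 * (c + 1) * r - β → x ∈ Icc (-r) r → y ∈ Icc (-r) r → -(2 * r) ≤ e →
      -(2 * r) ≤ e' → α - x ^ 2 + c * (x - y) = e → β - y ^ 2 - c * (x - y) = e' →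
      x ∈ Ioo (-r) r := by
    intro α β x y e e' hα hβ hx hy he he' h1 h2
    have hcy1 := mul_le_mul_of_nonneg_left hy.1 hc.le
    refine ⟨lt_of_le_of_ne hx.1 ?_, lt_of_le_of_ne hx.2 ?_⟩
    · rintro rfl
      linarith
    · rintro rfl
      have hy' : c * y = c * (-x) := le_antisymm (by linarith) hcy1
      have hyx : y = -x := mul_left_cancel₀ hc.ne' hy'
      subst hyx
      linarith
  rw [interior_prod_eq, interior_Icc]
  simp only [neighbourSum, Prod.ext_iff, Prod.fst_add, Prod.snd_add] at h
  have e0 : -(2 * r) ≤ w.1 + v.1 := by linarith [hw.1.1, hv.1.1]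
  have e1 : -(2 * r) ≤ w.2 + v.2 := by linarith [hw.2.1, hv.2.1]
  exact ⟨key (h2 0) (h2 1) hu.1 hu.2 e0 e1 h.1 h.2,
    key (h2 1) (h2 0) hu.2 hu.1 e1 e0 (by linarith [h.2]) (by linarith [h.1])⟩

theorem isFullCrossing_horseshoePiece (hB : ∀ i, IsBranchBox c (c ^ 2 / 4 + a i) r R)
    (h2 : ∀ i, 0 ≤ r ^ 2 - 2 * (c + 1) * r - a i) (s : Bool × Bool) :
    IsFullCrossing (coupledHenon a c) (Icc (-r) r ×ˢ Icc (-r) r) (Icc (-r) r ×ˢ Icc (-r) r)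
      (horseshoePiece a c r s) := by
  refine ⟨fun v hv => ⟨?_, ?_, ?_⟩, fun w hw => ⟨?_, ?_, ?_⟩, ?_, ?_⟩
  · exact fun p hp => hp.1.1
  · rintro ⟨u, _⟩ ⟨hp, rfl⟩ ⟨u', _⟩ ⟨hp', rfl⟩ he
    rw [mem_preimage, mem_piece_of_preimage] at hp hp'
    simp only [coupledHenon_apply] at he hp hp'
    rw [(existsUnique_middle hB s hp.1 hp.2.2.1).unique ⟨hp.2.1, hp.2.2.2, by abel⟩
      ⟨hp'.2.1, hp'.2.2.2, by rw [he]; abel⟩]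
  · intro w hw
    obtain ⟨u, ⟨hu, hs, he⟩, -⟩ := existsUnique_middle hB s hw hv
    refine ⟨(u, v), ⟨?_, rfl⟩, ?_⟩
    · rw [mem_preimage, mem_piece_of_preimage]
      exact ⟨by simpa [he] using hw, hu, hv, hs⟩
    · simp [coupledHenon_apply, he]
  · intro p hp
    simp only [coupledHenon_symm_apply]
    exact hp.1.2.2.1
  · rintro ⟨_, u⟩ ⟨hp, rfl⟩ ⟨_, u'⟩ ⟨hp', rfl⟩ he
    simp only [coupledHenon_symm_apply] at he
    exact Prod.ext rfl ((existsUnique_middle hB s hp.1 hp.2.2.1).unique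
      ⟨hp.2.1, hp.2.2.2, by abel⟩ ⟨hp'.2.1, hp'.2.2.2, by rw [he]; abel⟩)
  · intro v hv
    obtain ⟨u, ⟨hu, hs, he⟩, -⟩ := existsUnique_middle hB s hw hv
    exact ⟨(w, u), ⟨⟨hw, hu, by simpa [he] using hv, hs⟩, rfl⟩, by
      simp [coupledHenon_symm_apply, he]⟩
  · exact fun p hp => mem_interior_of_neighbours hB h2 hp.2.1 hp.1 hp.2.2.1 (by abel)
  · intro p hp
    rw [mem_preimage, mem_piece_of_preimage] at hp
    exact mem_interior_of_neighbours hB h2 hp.2.1 hp.1 hp.2.2.1 (by abel)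

theorem zpow_coupledHenon_orbit {z : ℤ → ℝ × ℝ}
    (hz : ∀ n, neighbourSum a c (z n) = z (n + 1) + z (n - 1)) (n : ℤ) :
    (coupledHenon a c ^ n) (z 0, z (-1)) = (z n, z (n - 1)) := by
  induction n with
  | zero => rfl
  | succ n ih =>
    rw [add_comm, zpow_add, zpow_one, Homeomorph.mul_apply, ih, coupledHenon_apply, hz]
    simp [add_comm]
  | pred n ih =>
    rw [sub_eq_add_neg, add_comm, zpow_add, zpow_neg_one, Homeomorph.mul_apply, ih]
    change (coupledHenon a c).symm _ = _
    rw [coupledHenon_symm_apply]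
    simp only [hz]
    rw [neg_add_eq_sub]
    simp

theorem hasTopologicalHorseshoe_coupledHenon (hB : ∀ i, IsBranchBox c (c ^ 2 / 4 + a i) r R)
    (h2 : ∀ i, 0 ≤ r ^ 2 - 2 * (c + 1) * r - a i) :
    HasTopologicalHorseshoe (coupledHenon a c)
      (Icc (-r) r ×ˢ Icc (-r) r) (Icc (-r) r ×ˢ Icc (-r) r) (Bool × Bool) := by
  set f := coupledHenon a c
  set V : Set Phase := (Icc (-r) r ×ˢ Icc (-r) r) ×ˢ (Icc (-r) r ×ˢ Icc (-r) r)
  have hsucc : ∀ (n : ℤ) (p : Phase), (f ^ (n + 1)) p = (f ^ n) (f p) := fun n p => by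
    rw [zpow_add, zpow_one]; rfl
  have hsucc' : ∀ (n : ℤ) (p : Phase), (f ^ (n + 1)) p = f ((f ^ n) p) := fun n p => by
    rw [add_comm, zpow_add, zpow_one]; rfl
  have huniq : ∀ {p : Phase} {s t : Bool × Bool}, p ∈ horseshoePiece a c r s →
      p ∈ horseshoePiece a c r t → s = t := fun {p s t} hs ht =>
    inQuadrant_unique hB hs.2.1 hs.1 hs.2.2.1 (by abel) hs.2.2.2 ht.2.2.2
  have hex : ∀ (p : maximalInvariantSet f V) (n : ℤ), ∃ s, (f ^ n) (p : Phase) ∈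
      horseshoePiece a c r s := by
    intro p n
    have h : (f ^ n) (p : Phase) ∈ f '' V ∩ V := by
      refine ⟨⟨(f ^ (n - 1)) p, p.2 (n - 1), ?_⟩, p.2 n⟩
      rw [← hsucc', sub_add_cancel]
    exact mem_iUnion.1 (iUnion_horseshoePiece.symm.subset h)
  choose h hh using hex
  refine ⟨horseshoePiece a c r, iUnion_horseshoePiece, disjoint_horseshoePiece hB,
    fun s => ⟨isCompact_horseshoePiece s, isConnected_horseshoePiece hB s,
      isFullCrossing_horseshoePiece hB h2 s⟩, h, ?_, ?_, ?_, hh⟩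
  · refine continuous_pi fun n => continuous_iff_isClosed.2 fun A _ => ?_
    have hA : (fun p => h p n) ⁻¹' A =
        ⋃ s ∈ A, {p : maximalInvariantSet f V | (f ^ n) (p : Phase) ∈ horseshoePiece a c r s} := by
      ext p
      simp only [mem_preimage, mem_iUnion, mem_ofPred_eq, exists_prop]
      constructor
      · exact fun hp => ⟨_, hp, hh p n⟩
      · rintro ⟨s, hs, hp⟩
        rwa [huniq (hh p n) hp]
    rw [hA]
    exact A.toFinite.isClosed_biUnion fun s _ => (isCompact_horseshoePiece s).isClosed.preimage
      ((f ^ n).continuous.comp continuous_subtype_val)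
  · intro s
    -- the second component of the `n`-th point lags one step behind
    obtain ⟨z, hz⟩ := exists_orbit_of_itinerary hB fun n => s (n + 1)
    have horb := zpow_coupledHenon_orbit fun n => (hz n).2.2
    refine ⟨⟨(z 0, z (-1)), fun n => ?_⟩, funext fun n => ?_⟩
    · rw [horb]
      exact ⟨(hz n).1, (hz (n - 1)).1⟩
    · refine huniq (hh _ n) ?_
      change (coupledHenon a c ^ n) (z 0, z (-1)) ∈ _
      rw [horb]
      have h1 := hz (n - 1)
      rw [sub_add_cancel] at h1
      exact ⟨(hz n).1, h1.1, by simpa [h1.2.2] using (hz (n - 1 - 1)).1, h1.2.1⟩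
  · intro p q hq n
    refine huniq (hh q n) ?_
    rw [hq, ← hsucc]
    exact hh p (n + 1)

/-- In the parameter range of the horseshoe the branches are defined and contract. -/
theorem exists_isBranchBox {ρ : ℝ} (hc : 0 < c) (hρ : 1 ≤ ρ)
    (hA : (a 0 + a 1) / 2 = ρ ^ 2 - 2 * ρ) (hr : r = 2 * √2 * ρ)
    (h1 : ∀ i, 0 < 1 / 4 * c ^ 2 + a i - (c + 2) * r)
    (h2 : ∀ i, 0 ≤ r ^ 2 - 2 * (c + 1) * r - a i) :
    ∃ R, ∀ i, IsBranchBox c (c ^ 2 / 4 + a i) r R := by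
  have hs : √2 ^ 2 = 2 := Real.sq_sqrt zero_le_two
  have hs0 : 0 < √2 := Real.sqrt_pos.2 two_pos
  have hr0 : 0 < r := by rw [hr]; positivity
  have hs2 : √2 ≤ 3 / 2 := by nlinarith
  have hρr : ρ = √2 * r / 4 := by rw [hr]; nlinarith
  -- averaging the upper bounds on `a 0` and `a 1` forces `r` to dominate `c`
  have hrc : c + 1 ≤ r := by
    have hA' : (a 0 + a 1) / 2 = r ^ 2 / 8 - √2 * r / 2 := by
      rw [hA, hρr]; nlinarith
    have h : 0 ≤ r * (7 / 8 * r + √2 / 2 - 2 * (c + 1)) := by nlinarith [h2 0, h2 1]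
    have := nonneg_of_mul_nonneg_right h hr0
    linarith
  have hK : 0 < c + 2 := by linarith
  obtain ⟨R, hrR, hR⟩ := exists_between
    (show r < min ((c ^ 2 / 4 + a 0) / (c + 2)) ((c ^ 2 / 4 + a 1) / (c + 2)) from
      lt_min ((lt_div_iff₀ hK).2 (by linarith [h1 0])) ((lt_div_iff₀ hK).2 (by linarith [h1 1])))
  rw [lt_min_iff, lt_div_iff₀ hK, lt_div_iff₀ hK] at hR
  have hRi : ∀ i, 0 < c ^ 2 / 4 + a i - (c + 2) * R := by
    intro i
    fin_cases i
    · simpa [mul_comm] using hR.1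
    · simpa [mul_comm] using hR.2
  refine ⟨R, fun i => ⟨hc, by linarith, hrR, hRi i, by nlinarith [h2 i], ?_⟩⟩
  nlinarith [h2 i, mul_nonneg (sub_nonneg.2 hrR.le) (sub_nonneg.2 hrc), sq_nonneg (R - r)]

end

/-! ### Uniform hyperbolicity -/

section
variable {E : Type*} [NormedAddCommGroup E] [NormedSpace ℝ E]

/-- The tangent vectors at `x` whose forward orbit under the derivative of `f` is bounded. For a
hyperbolic set of `f` this is the stable subspace, and for `f⁻¹` it is the unstable one. -/
def boundedSubspace (f : E → E) (x : E) : Submodule ℝ E where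
  carrier := {v | ∃ B, ∀ n : ℕ, ‖fderiv ℝ f^[n] x v‖ ≤ B}
  add_mem' := by
    rintro v w ⟨B, hB⟩ ⟨B', hB'⟩
    exact ⟨B + B', fun n => by
      rw [map_add]; exact (norm_add_le _ _).trans (add_le_add (hB n) (hB' n))⟩
  zero_mem' := ⟨0, fun n => by simp⟩
  smul_mem' := by
    rintro t v ⟨B, hB⟩
    exact ⟨‖t‖ * B, fun n => by
      rw [map_smul, norm_smul]; exact mul_le_mul_of_nonneg_left (hB n) (norm_nonneg t)⟩

theorem fderiv_iterate_succ {f : E → E} (hf : Differentiable ℝ f) (n : ℕ) (x v : E) :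
    fderiv ℝ f^[n + 1] x v = fderiv ℝ f^[n] (f x) (fderiv ℝ f x v) := by
  rw [Function.iterate_succ, fderiv_comp _ ((hf.iterate n) _) (hf x)]
  rfl

theorem fderiv_iterate_succ' {f : E → E} (hf : Differentiable ℝ f) (n : ℕ) (x v : E) :
    fderiv ℝ f^[n + 1] x v = fderiv ℝ f (f^[n] x) (fderiv ℝ f^[n] x v) := by
  rw [Function.iterate_succ', fderiv_comp _ (hf _) ((hf.iterate n) _)]
  rfl

theorem fderiv_symm_fderiv (f : E ≃ₜ E) (hf : Differentiable ℝ f) (hf' : Differentiable ℝ f.symm)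
    (x v : E) : fderiv ℝ f.symm (f x) (fderiv ℝ f x v) = v := by
  have h := fderiv_comp x (hf' (f x)) (hf x)
  rw [show f.symm ∘ f = id from funext f.symm_apply_apply, fderiv_id] at h
  exact (congrArg (fun L : E →L[ℝ] E => L v) h).symm

theorem map_fderiv_boundedSubspace (f : E ≃ₜ E) (hf : Differentiable ℝ f)
    (hf' : Differentiable ℝ f.symm) (x : E) :
    (boundedSubspace f x).map (fderiv ℝ f x : E →ₗ[ℝ] E) = boundedSubspace f (f x) := by
  apply le_antisymm
  · rintro _ ⟨v, ⟨B, hB⟩, rfl⟩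
    exact ⟨B, fun n => (fderiv_iterate_succ hf n x v) ▸ hB (n + 1)⟩
  · rintro w ⟨B, hB⟩
    have hw : fderiv ℝ f x (fderiv ℝ f.symm (f x) w) = w := by
      simpa using fderiv_symm_fderiv f.symm hf' hf (f x) w
    refine ⟨fderiv ℝ f.symm (f x) w, ⟨max ‖fderiv ℝ f.symm (f x) w‖ B, fun n => ?_⟩, hw⟩
    cases n with
    | zero => simp
    | succ n =>
      rw [fderiv_iterate_succ hf, hw]
      exact (hB n).trans (le_max_right _ _)

theorem map_fderiv_boundedSubspace_symm (f : E ≃ₜ E) (hf : Differentiable ℝ f)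
    (hf' : Differentiable ℝ f.symm) (x : E) :
    (boundedSubspace f.symm x).map (fderiv ℝ f x : E →ₗ[ℝ] E) = boundedSubspace f.symm (f x) := by
  have h := map_fderiv_boundedSubspace f.symm hf' hf (f x)
  rw [f.symm_apply_apply] at h
  rw [← h, ← Submodule.map_comp]
  convert Submodule.map_id _
  ext w
  simpa using fderiv_symm_fderiv f.symm hf' hf (f x) w

end

/-- A bounded sequence whose terms outweigh their neighbours as in `8 αₙ₊₁ ≤ αₙ₊₂ + αₙ` at least
halves at each step; otherwise it would double from some point on. -/
theorem halving_of_bounded {α : ℕ → ℝ} (h0 : ∀ n, 0 ≤ α n)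
    (h : ∀ n, 8 * α (n + 1) - α n ≤ α (n + 2)) {B : ℝ} (hB : ∀ n, α n ≤ B) (n : ℕ) :
    α (n + 1) ≤ α n / 2 := by
  by_contra! hlt
  have hpos : 0 < α (n + 1) := lt_of_le_of_lt (by linarith [h0 n]) hlt
  have hk : ∀ k : ℕ, 2 ^ k * α (n + 1) ≤ α (n + k + 1) ∧ α (n + k) / 2 < α (n + k + 1) := by
    intro k
    induction k with
    | zero => simpa using hlt
    | succ k ih =>
      have h1 := h (n + k)
      have e : 2 * α (n + k + 1) ≤ α (n + (k + 1) + 1) := by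
        rw [show n + (k + 1) + 1 = n + k + 2 by ring]
        linarith [h0 (n + k + 1)]
      have hp : 0 < α (n + k + 1) := lt_of_lt_of_le (by positivity) ih.1
      refine ⟨?_, ?_⟩
      · rw [pow_succ]; linarith [ih.1]
      · rw [show n + (k + 1) = n + k + 1 by ring] at *
        linarith
  obtain ⟨k, hk'⟩ := pow_unbounded_of_one_lt (B / α (n + 1)) one_lt_two
  rw [div_lt_iff₀ hpos] at hk'
  linarith [(hk k).1, hB (n + k + 1)]

theorem hasFDerivAt_coupledHenon (a : Fin 2 → ℝ) (c : ℝ) (p : Phase) :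
    ∃ L : Phase →L[ℝ] Phase, HasFDerivAt (coupledHenon a c) L p ∧ ∀ v : Phase, L v =
      (((c - 2 * p.1.1) * v.1.1 - c * v.1.2 - v.2.1, (c - 2 * p.1.2) * v.1.2 - c * v.1.1 - v.2.2),
        v.1) := by
  have hX : HasFDerivAt (fun q : Phase => q.1.1)
      ((ContinuousLinearMap.fst ℝ ℝ ℝ).comp (ContinuousLinearMap.fst ℝ (ℝ × ℝ) (ℝ × ℝ))) p :=
    ((ContinuousLinearMap.fst ℝ ℝ ℝ).comp
      (ContinuousLinearMap.fst ℝ (ℝ × ℝ) (ℝ × ℝ))).hasFDerivAt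
  have hY : HasFDerivAt (fun q : Phase => q.1.2)
      ((ContinuousLinearMap.snd ℝ ℝ ℝ).comp (ContinuousLinearMap.fst ℝ (ℝ × ℝ) (ℝ × ℝ))) p :=
    ((ContinuousLinearMap.snd ℝ ℝ ℝ).comp
      (ContinuousLinearMap.fst ℝ (ℝ × ℝ) (ℝ × ℝ))).hasFDerivAt
  have hZ : HasFDerivAt (fun q : Phase => q.2.1)
      ((ContinuousLinearMap.fst ℝ ℝ ℝ).comp (ContinuousLinearMap.snd ℝ (ℝ × ℝ) (ℝ × ℝ))) p :=
    ((ContinuousLinearMap.fst ℝ ℝ ℝ).comp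
      (ContinuousLinearMap.snd ℝ (ℝ × ℝ) (ℝ × ℝ))).hasFDerivAt
  have hW : HasFDerivAt (fun q : Phase => q.2.2)
      ((ContinuousLinearMap.snd ℝ ℝ ℝ).comp (ContinuousLinearMap.snd ℝ (ℝ × ℝ) (ℝ × ℝ))) p :=
    ((ContinuousLinearMap.snd ℝ ℝ ℝ).comp
      (ContinuousLinearMap.snd ℝ (ℝ × ℝ) (ℝ × ℝ))).hasFDerivAt
  have h := (((((hX.pow 2).const_sub (a 0)).sub hZ).add ((hX.sub hY).const_mul c)).prodMk
    ((((hY.pow 2).const_sub (a 1)).sub hW).sub ((hX.sub hY).const_mul c))).prodMk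
    (hX.prodMk hY)
  refine ⟨_, h, fun v => ?_⟩
  ext <;> simp <;> ring

section
variable {a : Fin 2 → ℝ} {c r : ℝ}

theorem differentiable_coupledHenon : Differentiable ℝ (coupledHenon a c) := fun p =>
  let ⟨_, hL, _⟩ := hasFDerivAt_coupledHenon a c p
  hL.differentiableAt

theorem fderiv_coupledHenon (p v : Phase) : fderiv ℝ (coupledHenon a c) p v =
    (((c - 2 * p.1.1) * v.1.1 - c * v.1.2 - v.2.1, (c - 2 * p.1.2) * v.1.2 - c * v.1.1 - v.2.2),
      v.1) := by
  obtain ⟨L, hL, hv⟩ := hasFDerivAt_coupledHenon a c p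
  rw [hL.fderiv, hv]

/-- The swap of the two factors as a continuous linear equivalence of the phase space. -/
def phaseSwapL : Phase ≃L[ℝ] Phase := ContinuousLinearEquiv.prodComm ℝ (ℝ × ℝ) (ℝ × ℝ)

theorem coupledHenon_symm_iterate (n : ℕ) :
    (coupledHenon a c).symm^[n] = phaseSwapL ∘ (coupledHenon a c)^[n] ∘ phaseSwapL := by
  funext p
  have h := (semiconj_phaseSwap a c).iterate_right n (phaseSwap p)
  exact h.symm

theorem differentiable_coupledHenon_symm : Differentiable ℝ (coupledHenon a c).symm := by
  have h := coupledHenon_symm_iterate (a := a) (c := c) 1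
  simp only [Function.iterate_one] at h
  rw [h]
  exact phaseSwapL.differentiable.comp
    (differentiable_coupledHenon.comp phaseSwapL.differentiable)

theorem fderiv_coupledHenon_symm_iterate (n : ℕ) (p v : Phase) :
    fderiv ℝ (coupledHenon a c).symm^[n] p v =
      phaseSwapL (fderiv ℝ (coupledHenon a c)^[n] (phaseSwap p) (phaseSwapL v)) := by
  have hd := differentiable_coupledHenon (a := a) (c := c)
  rw [coupledHenon_symm_iterate, phaseSwapL.comp_fderiv,
    fderiv_comp p ((hd.iterate n) _) phaseSwapL.differentiableAt, phaseSwapL.fderiv]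
  rfl

theorem norm_phaseSwapL (v : Phase) : ‖phaseSwapL v‖ = ‖v‖ := by
  change max ‖v.2‖ ‖v.1‖ = max ‖v.1‖ ‖v.2‖
  exact max_comm _ _

theorem mem_boundedSubspace_symm {p v : Phase} :
    v ∈ boundedSubspace (coupledHenon a c).symm p ↔
      phaseSwapL v ∈ boundedSubspace (coupledHenon a c) (phaseSwap p) := by
  change (∃ B, ∀ n : ℕ, _) ↔ ∃ B, ∀ n : ℕ, _
  simp only [fderiv_coupledHenon_symm_iterate, norm_phaseSwapL]

/-- Along the forward orbit of `p` both quadratic terms expand by at least `8 + 3 c`. -/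
def ExpandsAlong (a : Fin 2 → ℝ) (c : ℝ) (p : Phase) : Prop :=
  ∀ n : ℕ, 8 + 3 * c ≤ |c - 2 * ((coupledHenon a c)^[n] p).1.1| ∧
    8 + 3 * c ≤ |c - 2 * ((coupledHenon a c)^[n] p).1.2|

theorem eight_norm_sub_le (hc : 0 < c) {p v : Phase} (h1 : 8 + 3 * c ≤ |c - 2 * p.1.1|)
    (h2 : 8 + 3 * c ≤ |c - 2 * p.1.2|) :
    8 * ‖v.1‖ - ‖v.2‖ ≤ ‖(fderiv ℝ (coupledHenon a c) p v).1‖ := by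
  have key : ∀ {d x y z : ℝ}, 8 + 3 * c ≤ |d| → |y| ≤ |x| →
      8 * |x| - |z| ≤ |d * x - c * y - z| := by
    intro d x y z hd hyx
    have e1 := abs_sub_abs_le_abs_sub (d * x - c * y) z
    have e2 := abs_sub_abs_le_abs_sub (d * x) (c * y)
    rw [abs_mul, abs_mul, abs_of_pos hc] at e2
    nlinarith [mul_le_mul_of_nonneg_right hd (abs_nonneg x), mul_le_mul_of_nonneg_left hyx hc.le,
      mul_nonneg hc.le (abs_nonneg x)]
  rw [fderiv_coupledHenon]
  simp only [Prod.norm_def, Real.norm_eq_abs]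
  rcases le_total |v.1.2| |v.1.1| with h | h
  · rw [max_eq_left h]
    have := key (z := v.2.1) h1 h
    exact le_trans (by linarith [le_max_left |v.2.1| |v.2.2|]) (this.trans (le_max_left _ _))
  · rw [max_eq_right h]
    have := key (z := v.2.2) h2 h
    exact le_trans (by linarith [le_max_right |v.2.1| |v.2.2|]) (this.trans (le_max_right _ _))

/-- Vectors with a bounded forward orbit lie in the stable cone and are contracted. -/
theorem stable_estimates (hc : 0 < c) {p : Phase} (hp : ExpandsAlong a c p) {v : Phase}
    (hv : v ∈ boundedSubspace (coupledHenon a c) p) :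
    ‖v.1‖ ≤ ‖v.2‖ / 2 ∧
      ∀ n : ℕ, ‖fderiv ℝ (coupledHenon a c)^[n] p v‖ ≤ 1 * (1 / 2) ^ n * ‖v‖ := by
  obtain ⟨B, hB⟩ := hv
  set V : ℕ → Phase := fun n => fderiv ℝ (coupledHenon a c)^[n] p v with hV
  have hVs : ∀ n, V (n + 1) = fderiv ℝ (coupledHenon a c) ((coupledHenon a c)^[n] p) (V n) :=
    fun n => fderiv_iterate_succ' differentiable_coupledHenon n p v
  have h2 : ∀ n, (V (n + 1)).2 = (V n).1 := fun n => by rw [hVs, fderiv_coupledHenon]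
  have hhalf : ∀ n, ‖(V (n + 1)).2‖ ≤ ‖(V n).2‖ / 2 :=
    halving_of_bounded (α := fun n => ‖(V n).2‖) (fun n => norm_nonneg _) (fun n => by
      rw [h2 (n + 1), h2 n, hVs n]
      exact eight_norm_sub_le hc (hp n).1 (hp n).2)
      (B := B) (fun n => (norm_snd_le (V n)).trans (hB n))
  have h0 : V 0 = v := by simp [hV]
  refine ⟨by have := hhalf 0; rwa [h2, h0] at this, fun n => ?_⟩
  have hn : ∀ n, ‖(V n).2‖ ≤ (1 / 2) ^ n * ‖v‖ := by
    intro n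
    induction n with
    | zero => rw [h0]; simpa using norm_snd_le v
    | succ n ih => rw [pow_succ]; linarith [hhalf n]
  rw [one_mul]
  refine norm_prod_le_iff.2 ⟨?_, hn n⟩
  have := hhalf n
  rw [h2] at this
  exact this.trans (by linarith [hn n, norm_nonneg (V n).2])

/-- Every second component extends to a vector with bounded forward orbit: solving the linearised
recursion for its middle term is a contraction. -/
theorem exists_mem_boundedSubspace (hc : 0 < c) {p : Phase} (hp : ExpandsAlong a c p)
    (η : ℝ × ℝ) : ∃ ξ, (ξ, η) ∈ boundedSubspace (coupledHenon a c) p := by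
  set u : ℕ → ℝ × ℝ := fun n => ((coupledHenon a c)^[n] p).1 with hu
  have hd : ∀ n, c - 2 * (u n).1 ≠ 0 ∧ c - 2 * (u n).2 ≠ 0 := fun n =>
    ⟨abs_pos.1 (by linarith [(hp n).1]), abs_pos.1 (by linarith [(hp n).2])⟩
  have key : ∀ {d x₁ x₂ x₃ M : ℝ}, 8 + 3 * c ≤ |d| → |x₁| ≤ M → |x₂| ≤ M → |x₃| ≤ M →
      |(c * x₁ + x₂ + x₃) / d| ≤ 1 / 2 * M := by
    intro d x₁ x₂ x₃ M hd h1 h2 h3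
    have hM : 0 ≤ M := (abs_nonneg _).trans h1
    rw [abs_div, div_le_iff₀ (by linarith)]
    have e1 := abs_add_le (c * x₁ + x₂) x₃
    have e2 := abs_add_le (c * x₁) x₂
    rw [abs_mul, abs_of_pos hc] at e2
    nlinarith [mul_le_mul_of_nonneg_left h1 hc.le, mul_le_mul_of_nonneg_left hd hM,
      mul_nonneg hc.le hM]
  let P : (ℕ → ℝ × ℝ) → ℕ → ℝ × ℝ := fun z n => Nat.casesOn n η z
  let T : (ℕ → ℝ × ℝ) → ℕ → ℝ × ℝ := fun z n =>
    ((c * (z n).2 + (z (n + 1)).1 + (P z n).1) / (c - 2 * (u n).1),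
      (c * (z n).1 + (z (n + 1)).2 + (P z n).2) / (c - 2 * (u n).2))
  have hnorm : ∀ {w : ℝ × ℝ} {M : ℝ}, ‖w‖ ≤ M → |w.1| ≤ M ∧ |w.2| ≤ M := fun h =>
    norm_prod_le_iff.1 h
  have hP : ∀ z, (∀ n, z n ∈ Metric.closedBall (0 : ℝ × ℝ) ‖η‖) → ∀ n, ‖P z n‖ ≤ ‖η‖ := by
    intro z hz n
    cases n with
    | zero => exact le_rfl
    | succ n => exact mem_closedBall_zero_iff.1 (hz n)
  have hT : ∀ z, (∀ n, z n ∈ Metric.closedBall (0 : ℝ × ℝ) ‖η‖) → ∀ n,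
      T z n ∈ Metric.closedBall (0 : ℝ × ℝ) ‖η‖ := by
    intro z hz n
    have h1 := fun n => hnorm (mem_closedBall_zero_iff.1 (hz n))
    have h2 := hnorm (hP z hz n)
    refine mem_closedBall_zero_iff.2 (norm_prod_le_iff.2 ⟨?_, ?_⟩)
    · exact (key (hp n).1 (h1 n).2 (h1 (n + 1)).1 h2.1).trans (by linarith [norm_nonneg η])
    · exact (key (hp n).2 (h1 n).1 (h1 (n + 1)).2 h2.2).trans (by linarith [norm_nonneg η])
  have hz0 : ∀ n : ℕ, (fun _ : ℕ => (0 : ℝ × ℝ)) n ∈ Metric.closedBall (0 : ℝ × ℝ) ‖η‖ :=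
    fun n => Metric.mem_closedBall_self (norm_nonneg η)
  obtain ⟨z, hz, hzT⟩ := exists_fixedPoint_of_sup_contraction Metric.isClosed_closedBall T
    (κ := 1 / 2) (by norm_num) (by norm_num) hT (fun z w hz hw M hM n => by
      have h1 : ∀ n, |(z n).1 - (w n).1| ≤ M ∧ |(z n).2 - (w n).2| ≤ M := fun n =>
        hnorm (w := z n - w n) (by rw [← dist_eq_norm]; exact hM n)
      have h2 : |(P z n).1 - (P w n).1| ≤ M ∧ |(P z n).2 - (P w n).2| ≤ M := by
        cases n with
        | zero =>
          change |η.1 - η.1| ≤ M ∧ |η.2 - η.2| ≤ M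
          simpa using dist_nonneg.trans (hM 0)
        | succ n => exact h1 n
      rw [dist_eq_norm]
      refine norm_prod_le_iff.2 ⟨?_, ?_⟩
      · rw [Real.norm_eq_abs]
        convert key (hp n).1 (h1 n).2 (h1 (n + 1)).1 h2.1 using 2
        simp only [T, hu, Prod.fst_sub]
        ring
      · rw [Real.norm_eq_abs]
        convert key (hp n).2 (h1 n).1 (h1 (n + 1)).2 h2.2 using 2
        simp only [T, hu, Prod.snd_sub]
        ring)
    (fun _ => 0) hz0 (C := ‖η‖) (fun n => by
      rw [dist_zero_left]
      exact mem_closedBall_zero_iff.1 (hT _ hz0 n))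
  have hV : ∀ n, fderiv ℝ (coupledHenon a c)^[n] p (z 0, η) = (z n, P z n) := by
    intro n
    induction n with
    | zero => simp [P]
    | succ n ih =>
      rw [fderiv_iterate_succ' differentiable_coupledHenon, ih, fderiv_coupledHenon]
      have h1 : (c - 2 * (u n).1) * (z n).1 = c * (z n).2 + (z (n + 1)).1 + (P z n).1 := by
        rw [mul_comm, ← eq_div_iff (hd n).1]
        exact (congrArg Prod.fst (congrFun hzT n)).symm
      have h2 : (c - 2 * (u n).2) * (z n).2 = c * (z n).1 + (z (n + 1)).2 + (P z n).2 := by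
        rw [mul_comm, ← eq_div_iff (hd n).2]
        exact (congrArg Prod.snd (congrFun hzT n)).symm
      refine Prod.ext (Prod.ext ?_ ?_) rfl
      · change (c - 2 * (u n).1) * (z n).1 - c * (z n).2 - (P z n).1 = (z (n + 1)).1
        rw [h1]; ring
      · change (c - 2 * (u n).2) * (z n).2 - c * (z n).1 - (P z n).2 = (z (n + 1)).2
        rw [h2]; ring
  refine ⟨z 0, ‖η‖, fun n => ?_⟩
  rw [hV]
  exact norm_prod_le_iff.2 ⟨mem_closedBall_zero_iff.1 (hz n), hP z hz n⟩

theorem isCompl_boundedSubspace (hc : 0 < c) {p : Phase} (hp : ExpandsAlong a c p)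
    (hp' : ExpandsAlong a c (phaseSwap p)) :
    IsCompl (boundedSubspace (coupledHenon a c) p)
      (boundedSubspace (coupledHenon a c).symm p) := by
  have hdisj : Disjoint (boundedSubspace (coupledHenon a c) p)
      (boundedSubspace (coupledHenon a c).symm p) := by
    rw [Submodule.disjoint_def]
    intro v hs hu
    have h1 := (stable_estimates hc hp hs).1
    have h2 : ‖v.2‖ ≤ ‖v.1‖ / 2 := (stable_estimates hc hp' (mem_boundedSubspace_symm.1 hu)).1
    have e1 : ‖v.1‖ = 0 := by linarith [norm_nonneg v.1, norm_nonneg v.2]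
    have e2 : ‖v.2‖ = 0 := by linarith [norm_nonneg v.1, norm_nonneg v.2]
    exact Prod.ext (norm_eq_zero.1 e1) (norm_eq_zero.1 e2)
  -- both subspaces project onto a plane, so their dimensions add up to at least four
  have hs : 2 ≤ Module.finrank ℝ (boundedSubspace (coupledHenon a c) p) := by
    have hsurj : Function.Surjective ((LinearMap.snd ℝ (ℝ × ℝ) (ℝ × ℝ)).comp
        (boundedSubspace (coupledHenon a c) p).subtype) := fun η =>
      let ⟨ξ, hξ⟩ := exists_mem_boundedSubspace hc hp η
      ⟨⟨(ξ, η), hξ⟩, rfl⟩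
    simpa using LinearMap.finrank_le_finrank_of_surjective hsurj
  have hu : 2 ≤ Module.finrank ℝ (boundedSubspace (coupledHenon a c).symm p) := by
    have hsurj : Function.Surjective ((LinearMap.fst ℝ (ℝ × ℝ) (ℝ × ℝ)).comp
        (boundedSubspace (coupledHenon a c).symm p).subtype) := fun ξ =>
      let ⟨η, hη⟩ := exists_mem_boundedSubspace hc hp' ξ
      ⟨⟨(ξ, η), mem_boundedSubspace_symm.2 hη⟩, rfl⟩
    simpa using LinearMap.finrank_le_finrank_of_surjective hsurj
  refine ⟨hdisj, codisjoint_iff.2 (Submodule.eq_top_of_disjoint _ _ ?_ hdisj)⟩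
  have : Module.finrank ℝ Phase = 4 := by simp
  omega

theorem expandsAlong_of_subset_box (hc : 0 < c)
    (hΩ : nonwanderingSet (coupledHenon a c) ⊆
      (Icc (-r) r ×ˢ Icc (-r) r) ×ˢ (Icc (-r) r ×ˢ Icc (-r) r))
    (h3 : ∀ i, 4 + c < (-c + √(c ^ 2 + 4 * (a i - (c + 2) * r))) / 2) {p : Phase}
    (hp : p ∈ nonwanderingSet (coupledHenon a c)) : ExpandsAlong a c p := by
  have h3' : ∀ i, (8 + 3 * c) ^ 2 < c ^ 2 + 4 * (a i - (c + 2) * r) := fun i =>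
    (Real.lt_sqrt (by linarith)).1 (by linarith [h3 i])
  have hinv : ∀ q ∈ nonwanderingSet (coupledHenon a c),
      coupledHenon a c q ∈ nonwanderingSet (coupledHenon a c) := fun q hq =>
    image_nonwanderingSet (coupledHenon a c) ▸ mem_image_of_mem _ hq
  intro n
  have hn : (coupledHenon a c)^[n] p ∈ nonwanderingSet (coupledHenon a c) :=
    MapsTo.iterate hinv n hp
  generalize (coupledHenon a c)^[n] p = q at hn
  have hq := hΩ hn
  have hq' := (hΩ (hinv q hn)).1
  rw [coupledHenon_apply] at hq'
  obtain ⟨⟨hx, hy⟩, hz, hw⟩ := hq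
  obtain ⟨hx', hy'⟩ := hq'
  simp only [neighbourSum, Prod.fst_sub, Prod.snd_sub] at hx' hy'
  have e1 := mul_le_mul_of_nonneg_left hx.2 hc.le
  have e2 := mul_le_mul_of_nonneg_left hy.2 hc.le
  constructor
  · refine le_trans (le_abs_self _) (sq_le_sq.1 ((h3' 0).le.trans ?_))
    nlinarith [hx'.2, hz.2]
  · refine le_trans (le_abs_self _) (sq_le_sq.1 ((h3' 1).le.trans ?_))
    nlinarith [hy'.2, hw.2]

theorem isUniformlyHyperbolic_coupledHenon (hc : 0 < c)
    (hΩ : nonwanderingSet (coupledHenon a c) ⊆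
      (Icc (-r) r ×ˢ Icc (-r) r) ×ˢ (Icc (-r) r ×ˢ Icc (-r) r))
    (h3 : ∀ i, 4 + c < (-c + √(c ^ 2 + 4 * (a i - (c + 2) * r))) / 2) :
    IsUniformlyHyperbolic (coupledHenon a c) (nonwanderingSet (coupledHenon a c)) := by
  have hsq : IsCompact (Icc (-r) r ×ˢ Icc (-r) r : Set (ℝ × ℝ)) := isCompact_Icc.prod isCompact_Icc
  refine ⟨(hsq.prod hsq).of_isClosed_subset (isClosed_nonwanderingSet _) hΩ,
    image_nonwanderingSet _, 1, 1 / 2, boundedSubspace (coupledHenon a c),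
    boundedSubspace (coupledHenon a c).symm, one_pos, by norm_num, by norm_num, fun p hp => ?_⟩
  have h1 := expandsAlong_of_subset_box hc hΩ h3 hp
  have h2 := expandsAlong_of_subset_box hc hΩ h3 (swap_mem_nonwanderingSet hp)
  refine ⟨isCompl_boundedSubspace hc h1 h2,
    map_fderiv_boundedSubspace _ differentiable_coupledHenon differentiable_coupledHenon_symm p,
    map_fderiv_boundedSubspace_symm _ differentiable_coupledHenon
      differentiable_coupledHenon_symm p,
    fun v hv => (stable_estimates hc h1 hv).2, fun v hv n => ?_⟩
  rw [fderiv_coupledHenon_symm_iterate, norm_phaseSwapL, ← norm_phaseSwapL v]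
  exact (stable_estimates hc h2 (mem_boundedSubspace_symm.1 hv)).2 n

end

theorem theorem3p1 (a : Fin 2 → ℝ) (c A₀ r : ℝ) (hc : 0 < c)
    (hA₀ : A₀ = (a 0 + a 1) / 2) (hA₀_ge : -1 ≤ A₀)
    (hr : r = 2 * √2 * (1 + √(1 + A₀))) :
    nonwanderingSet (coupledHenon a c) ⊆
        {p | |p.1.1| ≤ r ∧ |p.1.2| ≤ r ∧ |p.2.1| ≤ r ∧ |p.2.2| ≤ r} ∧
    ((∀ i, 0 < 1 / 4 * c ^ 2 + a i - (c + 2) * r) →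
      (∀ i, 0 ≤ r ^ 2 - 2 * (c + 1) * r - a i) →
      HasTopologicalHorseshoe (coupledHenon a c)
        (Icc (-r) r ×ˢ Icc (-r) r) (Icc (-r) r ×ˢ Icc (-r) r) (Bool × Bool) ∧
      ((∀ i, 4 + c < (-c + √(c ^ 2 + 4 * (a i - (c + 2) * r))) / 2) →
        IsUniformlyHyperbolic (coupledHenon a c) (nonwanderingSet (coupledHenon a c)))) := by
  have hs := Real.sq_sqrt (show 0 ≤ 1 + A₀ by linarith)
  have hρ : 1 ≤ 1 + √(1 + A₀) := by linarith [Real.sqrt_nonneg (1 + A₀)]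
  have hA : (a 0 + a 1) / 2 = (1 + √(1 + A₀)) ^ 2 - 2 * (1 + √(1 + A₀)) := by
    rw [← hA₀]; linarith
  have hΩ : nonwanderingSet (coupledHenon a c) ⊆
      (Icc (-r) r ×ˢ Icc (-r) r) ×ˢ (Icc (-r) r ×ˢ Icc (-r) r) := by
    rw [hr]
    exact nonwanderingSet_subset_box hρ hA
  refine ⟨fun p hp => ?_, fun h1 h2 => ⟨?_, isUniformlyHyperbolic_coupledHenon hc hΩ⟩⟩
  · obtain ⟨⟨hx, hy⟩, hz, hw⟩ := hΩ hp
    exact ⟨abs_le.2 hx, abs_le.2 hy, abs_le.2 hz, abs_le.2 hw⟩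
  · obtain ⟨R, hB⟩ := exists_isBranchBox hc hρ hA hr h1 h2
    exact hasTopologicalHorseshoe_coupledHenon hB h2
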